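/- **Setting.** Let $d\ge 1$, $0<\sigma<L$, $c_0\in(0,1)$ and $B_X$ be real constants, and let $T\ge 1$ be the time horizon. For a set $\mathcal X\subseteq\mathbb R^d$ let $\mathcal X^o(r)=\{x:\mathbb B_2(x,r)\subseteq\mathcal X\}$, where $\mathbb B_2(x,r)$ is the closed Euclidean ball, and let $P_{\mathcal Z}$ be the Euclidean projection onto $\mathcal Z$. Let $\mathcal X\subseteq\mathbb R^d$ be nonempty, compact and convex with $\mathrm{diam}(\mathcal X)\le B_X$, and let $f_1,\dots,f_T:\mathcal X\to\mathbb R$ be twice continuously differentiable on $\mathcal X$ such that for all $t$ and all $x\in\mathcal X$: $|f_t(x)|\le 1$, $\max\{\|\nabla f_t(x)\|_2,\|\nabla^2f_t(x)\|_{\mathrm{op}}\}\le L$, $-\nabla^2 f_t(x)\succeq\sigma I$, and the maximizer $x_t^*$ of $f_t$ on $\mathcal X$ lies in $\mathcal X^o(c_0)$. Write $f_t^*=\max_{x\in\mathcal X}f_t(x)$ and $\Delta_{[1,t]}=\sum_{\tau=1}^{t-1}\sup_{x\in\mathcal X}|f_{\tau+1}(x)-f_\tau(x)|$. **Algorithm.**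 Put $\eta_0=1/L$, $\gamma=\sigma/L$, $N_0=\lceil c_0^{-2}\rceil+1$ and $$\kappa_0=\sqrt{\ln(dT)}+L+\frac{2d\ln T}{1-\gamma}+\frac{16B_X^2d^{3/2}\ln^4(dT)}{c_0(1-\gamma)^3}+\frac{2L^2d^{3/2}\ln^4(dT)}{c_0(1-\gamma)^7}.$$ Start from an arbitrary $z_0\in\mathcal X^o(c_0)$. For $s=0,1,2,\dots$ let $n_s=\lceil(1-\gamma)^{-4s}N_0\rceil$ and $\delta_s=n_s^{-1/4}$. Epoch $s$ consists of $d$ consecutive blocks, one for each coordinate $j=1,\dots,d$ in order, of $2n_s$ time periods each (the first block of epoch $0$ starts at $t=1$). In the block of coordinate $j$ the algorithm queries alternately $x_t=z_s+\delta_se_j$ (in the first period of the block and every second one after it) and $x_t=z_s-\delta_se_j$ (in the others), and observes $y_t$. If $u_+$ and $u_-$ are the sums of the observations of the two kinds in this block, $\hat g_s(j)=(u_+-u_-)/(2\delta_sn_s)$. After epoch $s$, $z_{s+1}=P_{\mathcal X^o(c_0)}(z_s+\eta_0\hat g_s)$. At every time $t$ the algorithm outputs $\bar r_t=\frac1t\sum_{\tau=1}^ty_\tau+\frac{2\kappa_0}{\sqrt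 t}$. **Feedback.** Let $(\mathcal F_t)_{t\ge0}$ be a filtration of a probability space such that $y_t$ is $\mathcal F_t$-measurable for $1\le t\le T$, $|y_t|\le 1$ almost surely, and almost surely $\mathbb E[y_t\mid\mathcal F_{t-1}]=f_t(x_t)$ whenever $x_t\in\mathcal X$. **Claim.** The estimates $\bar r_t$ are weakly non-stationary with $\rho(t)=6\kappa_0/\sqrt t$ and $\lambda=6\kappa_0$. That is: $\lambda>0$; on $t>0$, $\rho$ is decreasing and $t\mapsto t\rho(t)$ is increasing; and there is a sequence $p_T=\tilde O(T^{-2})$ (i.e. for some $q>0$, $\limsup_{T\to\infty}|p_T|\,T^2/\ln^qT<\infty$), depending only on $d,B_X,L,\sigma,c_0$, such that for every $T\ge 1$, every such instance with horizon $T$, and every $t\in\{1,\dots,T\}$ with $\Delta_{[1,t]}\le\rho(t)/\lambda$, with probability at least $1-p_T$ both 1. $\bar r_t\ge\min_{\tau\le t}f_\tau^*-\lambda\Delta_{[1,t]}$, and 2. $\frac1t\sum_{\tau=1}^t(\bar r_\tau-y_\tau)\le\rho(t)+\lambda\Delta_{[1,t]}$. -/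

import Mathlib

open MeasureTheory Filter Asymptotics

namespace Bandit

noncomputable section

/-- `a n = Õ(b n)`: bounded, as `n → ∞`, by a constant times `b n` times a positive power of
`ln n`. -/
def IsSoftO (a b : ℕ → ℝ) : Prop :=
  ∃ q : ℝ, 0 < q ∧ a =O[atTop] fun n => b n * Real.log n ^ q

/-- The space `ℝ^d` with its Euclidean norm. -/
abbrev Vec (d : ℕ) := EuclideanSpace ℝ (Fin d)

variable {d : ℕ}

/-- `X^o(r)`: the points whose closed ball of radius `r` lies in `X`. -/
def innerPart (X : Set (Vec d)) (r : ℝ) : Set (Vec d) :=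
  {x | Metric.closedBall x r ⊆ X}

/-- Euclidean projection onto `Z` (the nearest point of `Z`, unique for `Z` nonempty, closed and
convex). -/
def proj (Z : Set (Vec d)) (x : Vec d) : Vec d :=
  Classical.epsilon fun z => z ∈ Z ∧ ∀ w ∈ Z, ‖z - x‖ ≤ ‖w - x‖

/-- `‖g - h‖_∞` over the domain `X`. -/
def supDist (X : Set (Vec d)) (g h : Vec d → ℝ) : ℝ :=
  ⨆ x : X, |g x - h x|

/-- `Δ_{[s,t]} = ∑_{τ=s}^{t-1} ‖f_{τ+1} - f_τ‖_∞`. -/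
def variation (X : Set (Vec d)) (f : ℕ → Vec d → ℝ) (s t : ℕ) : ℝ :=
  ∑ τ ∈ Finset.Ico s t, supDist X (f (τ + 1)) (f τ)

/-- `max_{x ∈ X} g x`. -/
def maxValue (X : Set (Vec d)) (g : Vec d → ℝ) : ℝ :=
  ⨆ x : X, g x

/-- The standing assumptions on the domain `X` and on the functions `f_1, …, f_T`. Derivatives are
taken within `X`, which has nonempty interior by the last condition. -/
structure Assumptions (X : Set (Vec d)) (f : ℕ → Vec d → ℝ) (T : ℕ) (B L σ c₀ : ℝ) : Prop where
  nonempty : X.Nonempty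
  convex : Convex ℝ X
  compact : IsCompact X
  diam_le : ∀ x ∈ X, ∀ x' ∈ X, ‖x - x'‖ ≤ B
  bounded : ∀ t ∈ Finset.Icc 1 T, ∀ x ∈ X, |f t x| ≤ 1
  smooth : ∀ t ∈ Finset.Icc 1 T, ContDiffOn ℝ 2 (f t) X
  grad_le : ∀ t ∈ Finset.Icc 1 T, ∀ x ∈ X, ‖fderivWithin ℝ (f t) X x‖ ≤ L
  hess_le : ∀ t ∈ Finset.Icc 1 T, ∀ x ∈ X,
    ‖fderivWithin ℝ (fderivWithin ℝ (f t) X) X x‖ ≤ L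
  strong_concave : ∀ t ∈ Finset.Icc 1 T, ∀ x ∈ X, ∀ v : Vec d,
    σ * ‖v‖ ^ 2 ≤ -(fderivWithin ℝ (fderivWithin ℝ (f t) X) X x v v)
  interior_max : ∀ t ∈ Finset.Icc 1 T, ∀ x ∈ X, IsMaxOn (f t) X x → x ∈ innerPart X c₀

/-- Noisy bandit feedback `y_1, …, y_T` at the queries `x_1, …, x_T`: adapted, bounded by one, and
with conditional mean `f_t(x_t)` given the past at every query in the domain. Nothing but
boundedness is required of the feedback at a query outside the domain. -/
structure Feedback {Ω : Type*} {mΩ : MeasurableSpace Ω} (μ : Measure Ω) (ℱ : Filtration ℕ mΩ)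
    (X : Set (Vec d)) (f : ℕ → Vec d → ℝ) (T : ℕ) (x : ℕ → Ω → Vec d) (y : ℕ → Ω → ℝ) :
    Prop where
  adapted : ∀ t ∈ Finset.Icc 1 T, StronglyMeasurable[ℱ t] (y t)
  bounded : ∀ t ∈ Finset.Icc 1 T, ∀ᵐ ω ∂μ, |y t ω| ≤ 1
  unbiased : ∀ t ∈ Finset.Icc 1 T, ∀ᵐ ω ∂μ,
    x t ω ∈ X → (μ[y t | ℱ (t - 1)]) ω = f t (x t ω)

/-- The input parameters of the algorithm. -/
structure Params where
  η₀ : ℝ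
  κ₀ : ℝ
  γ : ℝ
  c₀ : ℝ
  N₀ : ℕ

namespace Params

variable (P : Params)

/-- `n_s = ⌈(1-γ)^{-4s} N₀⌉`. -/
def batch (s : ℕ) : ℕ := ⌈((1 - P.γ) ^ (4 * s))⁻¹ * (P.N₀ : ℝ)⌉₊

/-- `δ_s = n_s^{-1/4}`. -/
def radius (s : ℕ) : ℝ := (P.batch s : ℝ) ^ (-(1 / 4) : ℝ)

/-- The first time period of epoch `s` in dimension `d`: time starts at `1`, and epoch `i` consists
of `d` blocks (one per coordinate) of `2 n_i` periods each. -/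
def epochStart (d s : ℕ) : ℕ := 1 + ∑ i ∈ Finset.range s, d * (2 * P.batch i)

/-- The first time period of the block of coordinate `j` (counted from `0`) in epoch `s`. -/
def blockStart (d s j : ℕ) : ℕ := P.epochStart d s + j * (2 * P.batch s)

/-- The epoch that contains the time period `t ≥ 1`. -/
def epoch (d t : ℕ) : ℕ := Nat.findGreatest (fun s => P.epochStart d s ≤ t) t

/-- The gradient estimate of epoch `s` from the observations `y`:
`ĝ_s(j) = (u₊ - u₋) / (2 δ_s n_s)`, where `u₊` and `u₋` sum the observations at the even and odd
offsets of the block of coordinate `j`. -/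
def gradEst (y : ℕ → ℝ) (s : ℕ) : Vec d :=
  WithLp.toLp 2 fun j : Fin d =>
    ((∑ i ∈ Finset.range (P.batch s), y (P.blockStart d s j + 2 * i)) -
      ∑ i ∈ Finset.range (P.batch s), y (P.blockStart d s j + (2 * i + 1))) /
        (2 * P.radius s * P.batch s)

/-- The centres `z_s` of the epochs, by projected gradient ascent. -/
def center (X : Set (Vec d)) (z₀ : Vec d) (y : ℕ → ℝ) : ℕ → Vec d
  | 0 => z₀
  | s + 1 => proj (innerPart X P.c₀) (center X z₀ y s + P.η₀ • P.gradEst y s)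

/-- The query `x_t`: with `s` the epoch of `t` and `j` the coordinate explored at time `t`, it is
`z_s + δ_s e_j` at even and `z_s - δ_s e_j` at odd offsets from the start of the block. It depends
only on the observations before the start of epoch `s`. -/
def query (X : Set (Vec d)) (z₀ : Vec d) (y : ℕ → ℝ) (t : ℕ) : Vec d :=
  let s := P.epoch d t
  let j := (t - P.epochStart d s) / (2 * P.batch s)
  let e : Vec d := WithLp.toLp 2 fun k : Fin d => if (k : ℕ) = j then 1 else 0
  if Even (t - P.blockStart d s j) then P.center X z₀ y s + P.radius s • e
  else P.center X z₀ y s - P.radius s • e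

/-- The output `r̄_t = (y_1 + ⋯ + y_t) / t + 2 κ₀ / √t`. -/
def rbar (y : ℕ → ℝ) (t : ℕ) : ℝ :=
  (∑ τ ∈ Finset.Icc 1 t, y τ) / t + 2 * P.κ₀ / √t

end Params

/-- Weak non-stationarity over the horizon `T` with functions `ρ`, `lam`, the two properties holding
with probability at least `1 - p` at every `t ≤ T` with small variation. -/
structure WeaklyNonstationary {Ω : Type*} {mΩ : MeasurableSpace Ω} (μ : Measure Ω)
    (X : Set (Vec d)) (f : ℕ → Vec d → ℝ) (T : ℕ) (y r : ℕ → Ω → ℝ) (ρ : ℝ → ℝ) (lam p : ℝ) :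
    Prop where
  rho_decreasing : StrictAntiOn ρ (Set.Ioi 0)
  mul_rho_increasing : StrictMonoOn (fun t : ℝ => t * ρ t) (Set.Ioi 0)
  lam_pos : 0 < lam
  prob : ∀ t ∈ Finset.Icc 1 T, variation X f 1 t ≤ ρ t / lam →
    1 - p ≤ μ.real {ω |
      (⨅ τ : Set.Icc 1 t, maxValue X (f τ)) - lam * variation X f 1 t ≤ r t ω ∧
      (1 / (t : ℝ)) * ∑ τ ∈ Finset.Icc 1 t, (r τ ω - y τ ω) ≤ ρ t + lam * variation X f 1 t}

/-- The constant `κ₀` of the algorithm, with `γ = σ / L`. -/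
def kappa (d T : ℕ) (B L σ c₀ : ℝ) : ℝ :=
  √(Real.log (d * T)) + L + 2 * d * Real.log T / (1 - σ / L)
    + 16 * B ^ 2 * (d : ℝ) ^ (3 / 2 : ℝ) * Real.log (d * T) ^ 4 / (c₀ * (1 - σ / L) ^ 3)
    + 2 * L ^ 2 * (d : ℝ) ^ (3 / 2 : ℝ) * Real.log (d * T) ^ 4 / (c₀ * (1 - σ / L) ^ 7)

/-- The parameters `η₀ = 1/L`, `κ₀`, `γ = σ/L`, `c₀`, `N₀ = ⌈c₀⁻²⌉ + 1`. -/
def theParams (d T : ℕ) (B L σ c₀ : ℝ) : Params where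
  η₀ := 1 / L
  κ₀ := kappa d T B L σ c₀
  γ := σ / L
  c₀ := c₀
  N₀ := ⌈(c₀ ^ 2)⁻¹⌉₊ + 1

end

end Bandit

/-! Everything is compared with `f 1`. The condition on the variation says exactly `Δ_{[1,t]} ≤
1/√t`, so up to time `t` the rewards are those of `f 1` up to a drift of `1/√t`, and the algorithm
is noisy projected gradient ascent on one strongly concave function. In a completed epoch, noise,
drift and Taylor remainder each contribute an error of order `δ_s` to every coordinate of the
gradient estimate (`Run.abs_gradEst_sub_le`). For the drift this uses `n_s ≤ t`, hence `1/√t ≤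
δ_s²`. An exact step of length `1/L` contracts by `1 - γ` (`abs_inner_add_fderivWithin_sub_le`), and
`δ_s ≤ (1-γ)^s` decays at that same rate, so the distance of `z_s` from the maximizer of `f 1` is at
most `(1-γ)^s` times a factor affine in `s` (`Run.norm_center_sub_le`). The gradient vanishes at the
maximizer, so regret is quadratic in the distance. It is of order `(1-γ)^(2s)`, that is
`n_s^(-1/2)`, up to logarithms; batches grow geometrically, so a time `r` in epoch `s` is `O(n_s)`
and the regret at time `r` is `R/√r` (`Run.abs_sub_mean_le`). Summation and concentration put the
running mean of the rewards within `(2R+K)/√r` of `max f 1`, up to the drift, and both claims follow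
once `κ₀` dominates `2R+K` (`Run.rbar_bounds`). With `K` of order `√(log T)` and `O(log T)` epochs,
`R` is of order `log³ T`, whereas `κ₀` contains a positive multiple of `log⁴ T`. Hence `κ₀`
dominates beyond some `T₀` depending only on the constants, and below it `p_T = 1` makes the claim
empty. Randomness enters only through Azuma–Hoeffding on prefixes and blocks; the rest is a
deterministic argument about a `Run`. -/

namespace Bandit

/-! ### Exponential moments and the Azuma–Hoeffding inequality. -/

/-- Convexity: the graph of `exp` lies below its chord over `[-lc, lc]`. The bound is affine in `x`,
so for a centred `x` only the `cosh` term survives. -/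
theorem exp_mul_le_cosh_add_sinh {x c : ℝ} (l : ℝ) (h : |x| ≤ c) :
    Real.exp (l * x) ≤ Real.cosh (l * c) + x / c * Real.sinh (l * c) := by
  have hc : 0 ≤ c := (abs_nonneg x).trans h
  rcases hc.eq_or_lt with rfl | hc
  · have : x = 0 := abs_eq_zero.mp (le_antisymm h (abs_nonneg x))
    simp [this]
  obtain ⟨h1, h2⟩ := abs_le.mp h
  have hx1 : -1 ≤ x / c := by rw [le_div_iff₀ hc]; linarith
  have hx2 : x / c ≤ 1 := by rw [div_le_iff₀ hc]; linarith
  have := convexOn_exp.2 (Set.mem_univ (l * c)) (Set.mem_univ (-(l * c)))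
    (show 0 ≤ (1 + x / c) / 2 by linarith) (show 0 ≤ (1 - x / c) / 2 by linarith) (by ring)
  have e : ((1 + x / c) / 2) • (l * c) + ((1 - x / c) / 2) • (-(l * c)) = l * x := by
    simp only [smul_eq_mul]; field_simp; ring
  rw [e] at this
  refine this.trans (le_of_eq ?_)
  rw [Real.cosh_eq, Real.sinh_eq]
  simp only [smul_eq_mul]
  ring

section Azuma

variable {Ω : Type*} {mΩ : MeasurableSpace Ω} {μ : Measure Ω} [IsProbabilityMeasure μ]
  {ℱ : Filtration ℕ mΩ} {D : ℕ → Ω → ℝ} {c : ℕ → ℝ}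

theorem stronglyMeasurable_sum_range (hD : ∀ k, StronglyMeasurable[ℱ (k + 1)] (D k)) (n : ℕ) :
    StronglyMeasurable[ℱ n] fun ω => ∑ k ∈ Finset.range n, D k ω := by
  refine Finset.stronglyMeasurable_fun_sum (m := ℱ n) _ fun k hk => ?_
  exact (hD k).mono (ℱ.mono (Finset.mem_range.mp hk))

theorem stronglyMeasurable_exp_sum_range (hD : ∀ k, StronglyMeasurable[ℱ (k + 1)] (D k))
    (l : ℝ) (n : ℕ) :
    StronglyMeasurable[ℱ n] fun ω => Real.exp (l * ∑ k ∈ Finset.range n, D k ω) :=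
  Real.continuous_exp.comp_stronglyMeasurable
    ((stronglyMeasurable_sum_range hD n).const_mul l)

omit [IsProbabilityMeasure μ] in
theorem ae_norm_exp_sum_range_le (hb : ∀ k, ∀ᵐ ω ∂μ, |D k ω| ≤ c k) (l : ℝ) (n : ℕ) :
    ∀ᵐ ω ∂μ, ‖Real.exp (l * ∑ k ∈ Finset.range n, D k ω)‖ ≤
      Real.exp (|l| * ∑ k ∈ Finset.range n, c k) := by
  filter_upwards [ae_all_iff.mpr hb] with ω hω
  rw [Real.norm_eq_abs, Real.abs_exp, Real.exp_le_exp]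
  refine (le_abs_self _).trans ?_
  rw [abs_mul]
  gcongr
  exact (Finset.abs_sum_le_sum_abs _ _).trans (Finset.sum_le_sum fun k _ => hω k)

theorem integrable_exp_sum_range (hD : ∀ k, StronglyMeasurable[ℱ (k + 1)] (D k))
    (hb : ∀ k, ∀ᵐ ω ∂μ, |D k ω| ≤ c k) (l : ℝ) (n : ℕ) :
    Integrable (fun ω => Real.exp (l * ∑ k ∈ Finset.range n, D k ω)) μ :=
  Integrable.of_bound
    ((stronglyMeasurable_exp_sum_range hD l n).mono (ℱ.le n)).aestronglyMeasurable _
    (ae_norm_exp_sum_range_le hb l n)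

/-- Exponential moments of a sum of bounded martingale differences. -/
theorem integral_exp_sum_range_le (hD : ∀ k, StronglyMeasurable[ℱ (k + 1)] (D k))
    (hb : ∀ k, ∀ᵐ ω ∂μ, |D k ω| ≤ c k) (h0 : ∀ k, μ[D k | ℱ k] =ᵐ[μ] 0) (l : ℝ) (n : ℕ) :
    ∫ ω, Real.exp (l * ∑ k ∈ Finset.range n, D k ω) ∂μ ≤
      Real.exp (l ^ 2 / 2 * ∑ k ∈ Finset.range n, c k ^ 2) := by
  induction n with
  | zero => simp
  | succ n ih =>
    set E : Ω → ℝ := fun ω => Real.exp (l * ∑ k ∈ Finset.range n, D k ω) with hE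
    have hEi : Integrable E μ := integrable_exp_sum_range hD hb l n
    have hDi : Integrable (D n) μ :=
      Integrable.of_bound ((hD n).mono (ℱ.le _)).aestronglyMeasurable (c n) (hb n)
    have hEDi : Integrable (E * D n) μ :=
      hDi.bdd_mul hEi.aestronglyMeasurable (ae_norm_exp_sum_range_le hb l n)
    -- `E` is known at time `n`, so it can be pulled out of the conditional expectation of `E * D
    -- n`, which leaves that of `D n`.
    have hED : ∫ ω, E ω * D n ω ∂μ = 0 := by
      have h1 := condExp_mul_of_stronglyMeasurable_left (μ := μ) (m := ℱ n)
        (stronglyMeasurable_exp_sum_range hD l n) hEDi hDi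
      have h2 := integral_condExp (μ := μ) (f := E * D n) (ℱ.le n)
      change ∫ ω, (E * D n) ω ∂μ = 0
      rw [← h2, integral_congr_ae h1, integral_congr_ae (g := 0)]
      · simp
      · filter_upwards [h0 n] with ω hω
        simp [hω]
    calc ∫ ω, Real.exp (l * ∑ k ∈ Finset.range (n + 1), D k ω) ∂μ
        ≤ ∫ ω, (Real.cosh (l * c n) * E ω +
            Real.sinh (l * c n) / c n * (E ω * D n ω)) ∂μ := by
          refine integral_mono_ae (integrable_exp_sum_range hD hb l (n + 1))
            ((hEi.const_mul _).add (hEDi.const_mul _)) ?_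
          filter_upwards [hb n] with ω hω
          have := exp_mul_le_cosh_add_sinh l hω
          rw [Finset.sum_range_succ, mul_add, Real.exp_add]
          refine (mul_le_mul_of_nonneg_left this (Real.exp_pos _).le).trans (le_of_eq ?_)
          simp only [hE]
          ring
      _ = Real.cosh (l * c n) * ∫ ω, E ω ∂μ := by
          rw [integral_add (hEi.const_mul _)
            (show Integrable (fun ω => Real.sinh (l * c n) / c n * (E ω * D n ω)) μ from
              hEDi.const_mul _),
            integral_const_mul, integral_const_mul, hED, mul_zero, add_zero]
      _ ≤ Real.exp ((l * c n) ^ 2 / 2) *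
            Real.exp (l ^ 2 / 2 * ∑ k ∈ Finset.range n, c k ^ 2) := by
          gcongr
          · exact Real.cosh_le_exp_half_sq _
      _ = Real.exp (l ^ 2 / 2 * ∑ k ∈ Finset.range (n + 1), c k ^ 2) := by
          rw [← Real.exp_add, Finset.sum_range_succ]
          congr 1
          ring

/-- The one-sided Azuma–Hoeffding inequality. -/
theorem measureReal_le_sum_range (hD : ∀ k, StronglyMeasurable[ℱ (k + 1)] (D k))
    (hb : ∀ k, ∀ᵐ ω ∂μ, |D k ω| ≤ c k) (h0 : ∀ k, μ[D k | ℱ k] =ᵐ[μ] 0) (n : ℕ) {V ε : ℝ}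
    (hV : 0 < V) (hc : ∑ k ∈ Finset.range n, c k ^ 2 ≤ V) (hε : 0 ≤ ε) :
    μ.real {ω | ε ≤ ∑ k ∈ Finset.range n, D k ω} ≤ Real.exp (-(ε ^ 2 / (2 * V))) := by
  -- Chernoff's bound at the exponent `ε / V`, the minimizer of `l² V / 2 - l ε`.
  have h := ProbabilityTheory.measure_ge_le_exp_mul_mgf
    (X := fun ω => ∑ k ∈ Finset.range n, D k ω) ε
    (div_nonneg hε hV.le) (integrable_exp_sum_range hD hb (ε / V) n)
  refine h.trans ?_
  calc _ ≤ Real.exp (-(ε / V) * ε) * Real.exp ((ε / V) ^ 2 / 2 * V) := by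
        gcongr
        refine (integral_exp_sum_range_le hD hb h0 (ε / V) n).trans ?_
        gcongr
    _ = Real.exp (-(ε ^ 2 / (2 * V))) := by
        rw [← Real.exp_add]
        congr 1
        field_simp
        ring

/-- The two-sided Azuma–Hoeffding inequality. -/
theorem measureReal_le_abs_sum_range (hD : ∀ k, StronglyMeasurable[ℱ (k + 1)] (D k))
    (hb : ∀ k, ∀ᵐ ω ∂μ, |D k ω| ≤ c k) (h0 : ∀ k, μ[D k | ℱ k] =ᵐ[μ] 0) (n : ℕ) {V ε : ℝ}
    (hV : 0 < V) (hc : ∑ k ∈ Finset.range n, c k ^ 2 ≤ V) (hε : 0 ≤ ε) :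
    μ.real {ω | ε ≤ |∑ k ∈ Finset.range n, D k ω|} ≤ 2 * Real.exp (-(ε ^ 2 / (2 * V))) := by
  have h1 := measureReal_le_sum_range hD hb h0 n hV hc hε
  have h2 := measureReal_le_sum_range (μ := μ) (ℱ := ℱ) (D := fun k => -D k) (fun k => (hD k).neg)
    (by simpa using hb)
    (fun k => by
      filter_upwards [condExp_neg (μ := μ) (D k) (ℱ k), h0 k] with ω e1 e2
      rw [e1]; simp [e2]) n hV hc hε
  have : {ω | ε ≤ |∑ k ∈ Finset.range n, D k ω|} ⊆
      {ω | ε ≤ ∑ k ∈ Finset.range n, D k ω} ∪ {ω | ε ≤ ∑ k ∈ Finset.range n, (-D k) ω} := by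
    intro ω hω
    simp only [Set.mem_ofPred_eq, Set.mem_union, Pi.neg_apply, Finset.sum_neg_distrib] at hω ⊢
    exact le_abs.mp hω
  refine (measureReal_mono this).trans ((measureReal_union_le _ _).trans ?_)
  linarith

/-- Azuma–Hoeffding for a signed sum, over a set of times, of the deviations of a bounded adapted
process from its conditional means. -/
theorem measureReal_le_abs_sum_sub_condExp {y : ℕ → Ω → ℝ} {T : ℕ}
    (hy : ∀ t ∈ Finset.Icc 1 T, StronglyMeasurable[ℱ t] (y t))
    (hb : ∀ t ∈ Finset.Icc 1 T, ∀ᵐ ω ∂μ, |y t ω| ≤ 1)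
    {A : Finset ℕ} (hA : A ⊆ Finset.Icc 1 T) {w : ℕ → ℝ} (hw : ∀ k, |w k| ≤ 1) {N : ℕ}
    (hN : 0 < N) (hAN : A.card ≤ N) {ε : ℝ} (hε : 0 ≤ ε) :
    μ.real {ω | ε ≤ |∑ k ∈ A, w k * (y k ω - (μ[y k | ℱ (k - 1)]) ω)|} ≤
      2 * Real.exp (-(ε ^ 2 / (8 * N))) := by
  classical
  -- Times outside `A` contribute zero differences, so sums over `A` become sums over a range; the
  -- shift by one matches times starting at `1`.
  set D : ℕ → Ω → ℝ := fun k =>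
    if k + 1 ∈ A then w (k + 1) • (y (k + 1) - μ[y (k + 1) | ℱ k]) else 0 with hDdef
  have hyi : ∀ t ∈ Finset.Icc 1 T, Integrable (y t) μ := fun t ht =>
    Integrable.of_bound ((hy t ht).mono (ℱ.le _)).aestronglyMeasurable 1 (hb t ht)
  have hD : ∀ k, StronglyMeasurable[ℱ (k + 1)] (D k) := by
    intro k
    simp only [hDdef]
    split_ifs with h
    · exact ((hy _ (hA h)).sub
        (stronglyMeasurable_condExp.mono (ℱ.mono (Nat.le_succ k)))).const_smul _
    · exact stronglyMeasurable_zero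
  have hDb : ∀ k, ∀ᵐ ω ∂μ, |D k ω| ≤ if k + 1 ∈ A then 2 else 0 := by
    intro k
    simp only [hDdef]
    split_ifs with h
    · have hm := ae_bdd_abs_condExp_of_ae_bdd_abs (μ := μ) (m := ℱ k)
        (hb _ (hA h))
      filter_upwards [hb _ (hA h), hm] with ω h1 h2
      simp only [Pi.smul_apply, Pi.sub_apply, smul_eq_mul, abs_mul]
      have h3 : |y (k + 1) ω - (μ[y (k + 1) | ℱ k]) ω| ≤ 2 := by
        refine (abs_sub _ _).trans ?_
        have : |(μ[y (k + 1) | ℱ k]) ω| ≤ 1 := by simpa using h2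
        linarith
      nlinarith [hw (k + 1), abs_nonneg (w (k + 1)),
        abs_nonneg (y (k + 1) ω - (μ[y (k + 1) | ℱ k]) ω)]
    · simp
  have hD0 : ∀ k, μ[D k | ℱ k] =ᵐ[μ] 0 := by
    intro k
    simp only [hDdef]
    split_ifs with h
    · have hi := hyi _ (hA h)
      filter_upwards [condExp_smul (μ := μ) (w (k + 1)) (y (k + 1) - μ[y (k + 1) | ℱ k]) (ℱ k),
        condExp_sub (μ := μ) hi integrable_condExp (ℱ k) (g := μ[y (k + 1) | ℱ k])] with ω e1 e2
      rw [e1, Pi.smul_apply, e2, Pi.sub_apply,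
        condExp_of_stronglyMeasurable (ℱ.le k) stronglyMeasurable_condExp integrable_condExp]
      simp
    · rw [condExp_zero]
  have hre : ∀ g : ℕ → ℝ, ∑ k ∈ Finset.range T, (if k + 1 ∈ A then g (k + 1) else 0) =
      ∑ k ∈ A, g k := by
    intro g
    rw [Finset.range_eq_Ico, Finset.sum_Ico_add' (fun k => if k ∈ A then g k else 0) 0 T 1,
      ← Finset.sum_filter]
    congr 1
    ext k
    simp only [Finset.mem_filter, Finset.mem_Ico]
    refine ⟨fun h => h.2, fun h => ⟨?_, h⟩⟩
    have := Finset.mem_Icc.mp (hA h)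
    omega
  have hsum : ∀ ω, ∑ k ∈ Finset.range T, D k ω =
      ∑ k ∈ A, w k * (y k ω - (μ[y k | ℱ (k - 1)]) ω) := by
    intro ω
    rw [← hre]
    refine Finset.sum_congr rfl fun k _ => ?_
    simp only [hDdef, Nat.add_sub_cancel]
    split_ifs <;> simp
  have hcs : ∑ k ∈ Finset.range T, (if k + 1 ∈ A then (2 : ℝ) else 0) ^ 2 ≤ 4 * N := by
    have : ∀ k, (if k + 1 ∈ A then (2 : ℝ) else 0) ^ 2 = if k + 1 ∈ A then 4 else 0 := by
      intro k; split_ifs <;> norm_num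
    simp only [this]
    rw [hre fun _ => 4, Finset.sum_const, nsmul_eq_mul, mul_comm]
    gcongr
  -- A reward minus its conditional mean is at most `2` in absolute value, which gives `4` per
  -- summand.
  have := measureReal_le_abs_sum_range hD hDb hD0 T (V := 4 * N) (by positivity) hcs hε
  simp only [hsum] at this
  convert this using 4
  ring

end Azuma

/-! ### Projections, Taylor expansion and the contraction of gradient ascent. -/

section Geometry

variable {d : ℕ} {X : Set (Vec d)} {r : ℝ}

theorem innerPart_subset (hr : 0 ≤ r) : innerPart X r ⊆ X :=
  fun _ hx => hx (Metric.mem_closedBall_self hr)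

theorem innerPart_subset_interior (hr : 0 < r) : innerPart X r ⊆ interior X := fun _ hx =>
  mem_interior_iff_mem_nhds.mpr (Filter.mem_of_superset (Metric.closedBall_mem_nhds _ hr) hx)

theorem mem_innerPart_iff {x : Vec d} : x ∈ innerPart X r ↔ ∀ u : Vec d, ‖u‖ ≤ r → x + u ∈ X := by
  refine ⟨fun h u hu => h (by simpa using hu), fun h w hw => ?_⟩
  simpa using h (w - x) (by simpa [dist_eq_norm] using hw)

theorem isClosed_innerPart (hX : IsClosed X) : IsClosed (innerPart X r) := by
  have : innerPart X r = ⋂ (u : Vec d) (_ : ‖u‖ ≤ r), (fun x => x + u) ⁻¹' X := by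
    ext x
    simp [mem_innerPart_iff]
  rw [this]
  exact isClosed_iInter fun u => isClosed_iInter fun _ => hX.preimage (by fun_prop)

theorem convex_innerPart (hX : Convex ℝ X) : Convex ℝ (innerPart X r) := by
  intro x hx y hy a b ha hb hab
  rw [mem_innerPart_iff] at *
  intro u hu
  have := hX (hx u hu) (hy u hu) ha hb hab
  convert this using 1
  rw [smul_add, smul_add, add_add_add_comm, ← add_smul, hab, one_smul]

theorem proj_spec {Z : Set (Vec d)} (hZ : IsClosed Z) (hne : Z.Nonempty) (x : Vec d) :
    proj Z x ∈ Z ∧ ∀ w ∈ Z, ‖proj Z x - x‖ ≤ ‖w - x‖ := by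
  refine Classical.epsilon_spec (p := fun z => z ∈ Z ∧ ∀ w ∈ Z, ‖z - x‖ ≤ ‖w - x‖) ?_
  obtain ⟨z, hz, h⟩ := hZ.exists_infDist_eq_dist hne x
  refine ⟨z, hz, fun w hw => ?_⟩
  rw [← dist_eq_norm, ← dist_eq_norm, dist_comm z, dist_comm w, ← h]
  exact Metric.infDist_le_dist_of_mem hw

/-- At the projection, the angle between the directions to `x` and to `w` is not acute. -/
theorem norm_proj_sub_le {Z : Set (Vec d)} (hZ : IsClosed Z) (hc : Convex ℝ Z) (x : Vec d)
    {w : Vec d} (hw : w ∈ Z) : ‖proj Z x - w‖ ≤ ‖x - w‖ := by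
  obtain ⟨hz, hmin⟩ := proj_spec hZ ⟨w, hw⟩ x
  set z := proj Z x
  have : Nonempty Z := ⟨⟨w, hw⟩⟩
  have h1 : ‖x - z‖ = ⨅ w : Z, ‖x - w‖ := by
    refine le_antisymm (le_ciInf fun v => ?_) (ciInf_le ⟨0, ?_⟩ (⟨z, hz⟩ : Z))
    · rw [norm_sub_rev x z, norm_sub_rev x]
      exact hmin v v.2
    · rintro _ ⟨v, rfl⟩
      exact norm_nonneg _
  have h2 := (norm_eq_iInf_iff_real_inner_le_zero hc hz).mp h1 w hw
  have h3 : ‖x - w‖ ^ 2 = ‖x - z‖ ^ 2 - 2 * inner ℝ (x - z) (w - z) + ‖w - z‖ ^ 2 := by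
    rw [← norm_sub_sq_real]; congr 2; abel
  rw [norm_sub_rev z w]
  exact (pow_le_pow_iff_left₀ (norm_nonneg _) (norm_nonneg _) two_ne_zero).mp
    (by nlinarith [sq_nonneg ‖x - z‖])

/-- A symmetric bilinear form is bounded as its quadratic form is. -/
theorem abs_apply_le_of_symm {E : Type*} [NormedAddCommGroup E] [InnerProductSpace ℝ E]
    (A : E →L[ℝ] E →L[ℝ] ℝ) {c : ℝ} (hs : ∀ u v, A u v = A v u) (h0 : ∀ v, 0 ≤ A v v)
    (h1 : ∀ v, A v v ≤ c * ‖v‖ ^ 2) (u v : E) : |A u v| ≤ c * ‖u‖ * ‖v‖ := by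
  have key : ∀ u v : E, A u v ≤ c * ‖u‖ * ‖v‖ := by
    intro u v
    rcases eq_or_ne u 0 with rfl | hu
    · simp
    rcases eq_or_ne v 0 with rfl | hv
    · simp
    have ha := norm_pos_iff.mpr hu
    have hb := norm_pos_iff.mpr hv
    have hc : 0 ≤ c := by
      have := (h0 u).trans (h1 u)
      exact nonneg_of_mul_nonneg_left this (by positivity)
    -- Polarization. Scaling both vectors to the same length makes the triangle inequality for the
    -- sum lossless enough to keep the constant `c`.
    have e1 := h1 (‖v‖ • u + ‖u‖ • v)
    have e2 := h0 (‖v‖ • u - ‖u‖ • v)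
    have e3 : ‖‖v‖ • u + ‖u‖ • v‖ ≤ 2 * (‖u‖ * ‖v‖) := by
      refine (norm_add_le _ _).trans (le_of_eq ?_)
      rw [norm_smul, norm_smul, norm_norm, norm_norm]; ring
    have e4 : ‖‖v‖ • u + ‖u‖ • v‖ ^ 2 ≤ (2 * (‖u‖ * ‖v‖)) ^ 2 := by gcongr
    have e5 := e1.trans (mul_le_mul_of_nonneg_left e4 hc)
    simp only [map_add, map_sub, map_smul, add_apply,
      sub_apply, smul_apply, smul_eq_mul, hs v u] at e5 e2
    have hab : 0 < ‖u‖ * ‖v‖ := by positivity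
    have e6 : ‖u‖ * ‖v‖ * A u v ≤ ‖u‖ * ‖v‖ * (c * ‖u‖ * ‖v‖) := by nlinarith
    exact le_of_mul_le_mul_left e6 hab
  rw [abs_le]
  refine ⟨?_, key u v⟩
  have := key u (-v)
  simp only [map_neg, norm_neg] at this
  linarith

variable {f : Vec d → ℝ} {L σ : ℝ}

theorem differentiableOn_fderivWithin (hX : Convex ℝ X) (hne : (interior X).Nonempty)
    (hf : ContDiffOn ℝ 2 f X) : DifferentiableOn ℝ (fderivWithin ℝ f X) X :=
  (hf.fderivWithin (uniqueDiffOn_convex hX hne) (m := 1) (by norm_num)).differentiableOn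
    (by norm_num)

theorem norm_fderivWithin_sub_le (hX : Convex ℝ X) (hne : (interior X).Nonempty)
    (hf : ContDiffOn ℝ 2 f X)
    (hL : ∀ x ∈ X, ‖fderivWithin ℝ (fderivWithin ℝ f X) X x‖ ≤ L) {x z : Vec d} (hx : x ∈ X)
    (hz : z ∈ X) : ‖fderivWithin ℝ f X z - fderivWithin ℝ f X x‖ ≤ L * ‖z - x‖ :=
  hX.norm_image_sub_le_of_norm_fderivWithin_le (differentiableOn_fderivWithin hX hne hf) hL hx hz

/-- First order Taylor expansion with quadratic remainder. -/
theorem abs_sub_sub_fderivWithin_le (hX : Convex ℝ X) (hne : (interior X).Nonempty)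
    (hf : ContDiffOn ℝ 2 f X) (hL0 : 0 ≤ L)
    (hL : ∀ x ∈ X, ‖fderivWithin ℝ (fderivWithin ℝ f X) X x‖ ≤ L) {x z : Vec d} (hx : x ∈ X)
    (hz : z ∈ X) : |f z - f x - fderivWithin ℝ f X x (z - x)| ≤ L * ‖z - x‖ ^ 2 := by
  have hsub : segment ℝ x z ⊆ X := hX.segment_subset hx hz
  -- Mean value inequality on the segment, where the derivative varies by at most `L‖z - x‖`. It
  -- loses the factor `1/2`, which is harmless.
  have := (convex_segment x z).norm_image_sub_le_of_norm_hasFDerivWithin_le'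
    (f := f) (f' := fderivWithin ℝ f X) (φ := fderivWithin ℝ f X x) (C := L * ‖z - x‖)
    (fun w hw => ((hf.differentiableOn (by norm_num) w (hsub hw)).hasFDerivWithinAt).mono hsub)
    (fun w hw => (norm_fderivWithin_sub_le hX hne hf hL hx (hsub hw)).trans
      (mul_le_mul_of_nonneg_left (norm_sub_le_of_mem_segment hw) hL0))
    (left_mem_segment ℝ x z) (right_mem_segment ℝ x z)
  rw [Real.norm_eq_abs] at this
  linarith [this]

/-- A gradient ascent step of length `1 / L` for an `L`-smooth and `σ`-strongly concave function
contracts by the factor `1 - σ / L`. -/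
theorem abs_inner_add_fderivWithin_sub_le (hX : Convex ℝ X) (hne : (interior X).Nonempty)
    (hf : ContDiffOn ℝ 2 f X) (hL0 : 0 < L) (hσL : σ ≤ L)
    (hL : ∀ x ∈ X, ‖fderivWithin ℝ (fderivWithin ℝ f X) X x‖ ≤ L)
    (hσ : ∀ x ∈ X, ∀ v : Vec d, σ * ‖v‖ ^ 2 ≤ -(fderivWithin ℝ (fderivWithin ℝ f X) X x v v))
    {x z : Vec d} (hx : x ∈ X) (hz : z ∈ X) (u : Vec d) :
    |inner ℝ u (z - x) + 1 / L * (fderivWithin ℝ f X z u - fderivWithin ℝ f X x u)| ≤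
      (1 - σ / L) * ‖u‖ * ‖z - x‖ := by
  set H := fderivWithin ℝ (fderivWithin ℝ f X) X with hH
  have hd := differentiableOn_fderivWithin hX hne hf
  -- The derivative of this map is `I + H/L` paired with `u`. As a quadratic form `I + H/L` lies
  -- between `0` and `1 - σ/L`, so the mean value inequality gives the contraction.
  have hφ : ∀ w ∈ X, HasFDerivWithinAt (fun w => inner ℝ u w + 1 / L * fderivWithin ℝ f X w u)
      (innerSL ℝ u + (1 / L : ℝ) • (H w).flip u) X w := by
    intro w hw
    have h1 : HasFDerivWithinAt (fun w => fderivWithin ℝ f X w u) ((H w).flip u) X w := by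
      have := (hd w hw).hasFDerivWithinAt.clm_apply (hasFDerivWithinAt_const u w X)
      simpa using this
    exact (innerSL ℝ u).hasFDerivWithinAt.add (h1.const_mul (1 / L))
  have hbound : ∀ w ∈ X, ‖innerSL ℝ u + (1 / L : ℝ) • (H w).flip u‖ ≤ (1 - σ / L) * ‖u‖ := by
    intro w hw
    have hγ : 0 ≤ 1 - σ / L := by
      rw [sub_nonneg, div_le_one hL0]; exact hσL
    refine ContinuousLinearMap.opNorm_le_bound _ (by positivity) fun v => ?_
    -- Symmetry is needed at boundary points too; it holds because a convex set with nonempty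
    -- interior lies in the closure of that interior.
    have hsym : IsSymmSndFDerivWithinAt ℝ f X w := by
      refine (hf w hw).isSymmSndFDerivWithinAt (by simp) (uniqueDiffOn_convex hX hne) ?_ hw
      rw [hX.closure_interior_eq_closure_of_nonempty_interior hne]
      exact subset_closure hw
    have hsym' : ∀ u v, H w u v = H w v u := fun u v => hsym.eq u v
    let J : Vec d →L[ℝ] Vec d →L[ℝ] ℝ := innerSL ℝ
    have hJ : ∀ a b, J a b = inner ℝ a b := fun a b => rfl
    have := abs_apply_le_of_symm (J + (1 / L : ℝ) • H w) (c := 1 - σ / L)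
      (fun a b => by
        simp only [add_apply, smul_apply, smul_eq_mul,
          hJ, real_inner_comm, hsym' a b])
      (fun v => by
        simp only [add_apply, smul_apply, smul_eq_mul,
          hJ, real_inner_self_eq_norm_sq]
        have h1 : |H w v v| ≤ L * ‖v‖ ^ 2 := by
          refine ((H w).le_opNorm₂ v v).trans ?_
          rw [mul_assoc, ← sq]
          exact mul_le_mul_of_nonneg_right (hL w hw) (by positivity)
        have h2 : -(L * ‖v‖ ^ 2) ≤ H w v v := (abs_le.mp h1).1
        have h3 : 1 / L * -(L * ‖v‖ ^ 2) ≤ 1 / L * H w v v := by gcongr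
        have h4 : 1 / L * -(L * ‖v‖ ^ 2) = -‖v‖ ^ 2 := by field_simp
        linarith)
      (fun v => by
        simp only [add_apply, smul_apply, smul_eq_mul,
          hJ, real_inner_self_eq_norm_sq]
        have h3 : 1 / L * (σ * ‖v‖ ^ 2) ≤ 1 / L * -(H w v v) := by
          gcongr
          exact hσ w hw v
        have h4 : 1 / L * (σ * ‖v‖ ^ 2) = σ / L * ‖v‖ ^ 2 := by ring
        linarith) u v
    simp only [add_apply, smul_apply, smul_eq_mul,
      ContinuousLinearMap.flip_apply, Real.norm_eq_abs, hJ, innerSL_apply_apply, hsym' u v] at this ⊢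
    exact this
  have := hX.norm_image_sub_le_of_norm_hasFDerivWithin_le hφ hbound hx hz
  rw [Real.norm_eq_abs] at this
  convert this using 2
  rw [inner_sub_right]
  ring

end Geometry

/-! ### The schedule of epochs and its geometric growth. -/

namespace Params

section Schedule

variable {P : Params} {d : ℕ}

theorem le_batch (s : ℕ) : ((1 - P.γ) ^ (4 * s))⁻¹ * (P.N₀ : ℝ) ≤ P.batch s := Nat.le_ceil _

theorem one_le_inv_pow (h0 : 0 < 1 - P.γ) (h1 : 1 - P.γ < 1) (s : ℕ) :
    1 ≤ ((1 - P.γ) ^ (4 * s))⁻¹ :=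
  (one_le_inv₀ (by positivity)).mpr (pow_le_one₀ h0.le h1.le)

theorem inv_pow_le_batch (h0 : 0 < 1 - P.γ) (hN : 1 ≤ P.N₀) (s : ℕ) :
    ((1 - P.γ) ^ (4 * s))⁻¹ ≤ P.batch s := by
  have hN' : (1 : ℝ) ≤ P.N₀ := by exact_mod_cast hN
  have hpos : 0 ≤ ((1 - P.γ) ^ (4 * s))⁻¹ := by positivity
  exact (le_mul_of_one_le_right hpos hN').trans (le_batch s)

theorem one_le_batch (h0 : 0 < 1 - P.γ) (h1 : 1 - P.γ < 1) (hN : 1 ≤ P.N₀) (s : ℕ) :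
    (1 : ℝ) ≤ P.batch s :=
  (one_le_inv_pow h0 h1 s).trans (inv_pow_le_batch h0 hN s)

theorem batch_pos (h0 : 0 < 1 - P.γ) (h1 : 1 - P.γ < 1) (hN : 1 ≤ P.N₀) (s : ℕ) :
    0 < P.batch s := by
  exact_mod_cast one_pos.trans_le (one_le_batch h0 h1 hN s)

/-- Rounding up a number that is at least `1` at most doubles it. -/
theorem batch_le (h0 : 0 < 1 - P.γ) (h1 : 1 - P.γ < 1) (hN : 1 ≤ P.N₀) (s : ℕ) :
    (P.batch s : ℝ) ≤ 2 * P.N₀ * ((1 - P.γ) ^ (4 * s))⁻¹ := by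
  have hN' : (1 : ℝ) ≤ P.N₀ := by exact_mod_cast hN
  have h2 := one_le_inv_pow h0 h1 s
  have h3 : 1 ≤ ((1 - P.γ) ^ (4 * s))⁻¹ * (P.N₀ : ℝ) := one_le_mul_of_one_le_of_one_le h2 hN'
  have h4 := Nat.ceil_lt_add_one (zero_le_one.trans h3)
  have : (P.batch s : ℝ) = (⌈((1 - P.γ) ^ (4 * s))⁻¹ * (P.N₀ : ℝ)⌉₊ : ℝ) := rfl
  linarith

theorem batch_mono (h0 : 0 < 1 - P.γ) (h1 : 1 - P.γ < 1) : Monotone P.batch := by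
  intro s t hst
  refine Nat.ceil_le_ceil ?_
  gcongr ?_ * _
  refine (inv_le_inv₀ (by positivity) (by positivity)).mpr ?_
  exact pow_le_pow_of_le_one h0.le h1.le (by omega)

theorem radius_nonneg (s : ℕ) : 0 ≤ P.radius s := Real.rpow_nonneg (Nat.cast_nonneg _) _

theorem radius_pos (h0 : 0 < 1 - P.γ) (h1 : 1 - P.γ < 1) (hN : 1 ≤ P.N₀) (s : ℕ) :
    0 < P.radius s := Real.rpow_pos_of_pos (by exact_mod_cast batch_pos h0 h1 hN s) _

theorem radius_sq (s : ℕ) : P.radius s ^ 2 = (√(P.batch s : ℝ))⁻¹ := by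
  rw [radius, Real.sqrt_eq_rpow, ← Real.rpow_neg (Nat.cast_nonneg _), ← Real.rpow_natCast,
    ← Real.rpow_mul (Nat.cast_nonneg _)]
  norm_num

theorem radius_le_pow (h0 : 0 < 1 - P.γ) (hN : 1 ≤ P.N₀) (s : ℕ) :
    P.radius s ≤ (1 - P.γ) ^ s := by
  have h2 := inv_pow_le_batch h0 hN s
  have hp : 0 < ((1 - P.γ) ^ (4 * s))⁻¹ := by positivity
  refine (pow_le_pow_iff_left₀ (radius_nonneg s) (by positivity) (n := 4) (by norm_num)).mp ?_
  have e : P.radius s ^ 4 = (P.batch s : ℝ)⁻¹ := by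
    rw [show P.radius s ^ 4 = (P.radius s ^ 2) ^ 2 by ring, radius_sq, inv_pow,
      Real.sq_sqrt (Nat.cast_nonneg _)]
  rw [e, ← pow_mul, mul_comm s 4, ← inv_inv ((1 - P.γ) ^ (4 * s))]
  exact (inv_le_inv₀ (hp.trans_le h2) hp).mpr h2

/-- Converse to `radius_le_pow` up to a constant: it turns squared distances of order `(1-γ)^(2s)`
into regret of order `n_s^(-1/2)`. -/
theorem pow_sq_le (h0 : 0 < 1 - P.γ) (h1 : 1 - P.γ < 1) (hN : 1 ≤ P.N₀) (s : ℕ) :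
    ((1 - P.γ) ^ s) ^ 2 ≤ √(2 * P.N₀) * (√(P.batch s : ℝ))⁻¹ := by
  have hb : (0 : ℝ) < P.batch s := by exact_mod_cast batch_pos h0 h1 hN s
  have h2 := batch_le h0 h1 hN s
  have hp : 0 < (1 - P.γ) ^ (4 * s) := by positivity
  rw [← Real.sqrt_inv, ← Real.sqrt_mul (by positivity)]
  refine Real.le_sqrt_of_sq_le ?_
  rw [← pow_mul, ← pow_mul, show s * (2 * 2) = 4 * s by ring, ← div_eq_mul_inv, le_div_iff₀ hb]
  calc _ ≤ (1 - P.γ) ^ (4 * s) * (2 * P.N₀ * ((1 - P.γ) ^ (4 * s))⁻¹) := by gcongr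
    _ = 2 * P.N₀ := by field_simp

theorem epochStart_succ (s : ℕ) :
    P.epochStart d (s + 1) = P.epochStart d s + d * (2 * P.batch s) := by
  rw [epochStart, epochStart, Finset.sum_range_succ, add_assoc]

theorem epochStart_mono : Monotone (P.epochStart d) :=
  monotone_nat_of_le_succ fun s => by rw [epochStart_succ]; exact Nat.le_add_right _ _

/-- Justifies the cut-off `t` in the search that defines `epoch`: no epoch of index above `t` starts
by time `t`. -/
theorem lt_epochStart (h0 : 0 < 1 - P.γ) (h1 : 1 - P.γ < 1) (hN : 1 ≤ P.N₀) (hd : 1 ≤ d)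
    (s : ℕ) : s < P.epochStart d s := by
  induction s with
  | zero => simp [epochStart]
  | succ s ih =>
    rw [epochStart_succ]
    have := Nat.mul_le_mul hd (show 1 ≤ 2 * P.batch s by have := batch_pos h0 h1 hN s; omega)
    omega

theorem epochStart_epoch_le {t : ℕ} (ht : 1 ≤ t) : P.epochStart d (P.epoch d t) ≤ t :=
  Nat.findGreatest_spec (P := fun s => P.epochStart d s ≤ t) (Nat.zero_le t)
    (by simpa [epochStart] using ht)

theorem lt_epochStart_epoch_succ (h0 : 0 < 1 - P.γ) (h1 : 1 - P.γ < 1) (hN : 1 ≤ P.N₀)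
    (hd : 1 ≤ d) (t : ℕ) : t < P.epochStart d (P.epoch d t + 1) := by
  by_contra! h
  have h2 := lt_epochStart h0 h1 hN hd (P.epoch d t + 1)
  exact Nat.findGreatest_is_greatest (P := fun s => P.epochStart d s ≤ t)
    (Nat.lt_succ_self (P.epoch d t)) (by omega) h

theorem le_epoch (h0 : 0 < 1 - P.γ) (h1 : 1 - P.γ < 1) (hN : 1 ≤ P.N₀) (hd : 1 ≤ d) {s t : ℕ}
    (h : P.epochStart d s ≤ t) : s ≤ P.epoch d t :=
  Nat.le_findGreatest (by have := lt_epochStart h0 h1 hN hd s; omega) h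

theorem epoch_eq (h0 : 0 < 1 - P.γ) (h1 : 1 - P.γ < 1) (hN : 1 ≤ P.N₀) (hd : 1 ≤ d) {s t : ℕ}
    (h : P.epochStart d s ≤ t) (h' : t < P.epochStart d (s + 1)) : P.epoch d t = s := by
  refine le_antisymm ?_ (le_epoch h0 h1 hN hd h)
  have ht : 1 ≤ t := le_trans (by rw [epochStart]; omega) h
  by_contra! hlt
  have := (epochStart_mono (P := P) (d := d) (show s + 1 ≤ P.epoch d t from hlt)).trans
    (epochStart_epoch_le ht)
  omega

/-- A geometric sum is comparable to its last term. The right-hand side grows by exactly the bound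
of `batch_le` from one `s` to the next. -/
theorem sum_batch_le (h0 : 0 < 1 - P.γ) (h1 : 1 - P.γ < 1) (hN : 1 ≤ P.N₀) (s : ℕ) :
    ∑ i ∈ Finset.range (s + 1), (P.batch i : ℝ) ≤
      2 * P.N₀ * ((1 - P.γ) ^ (4 * s))⁻¹ / (1 - (1 - P.γ) ^ 4) := by
  have hq : 0 < 1 - (1 - P.γ) ^ 4 := sub_pos.mpr (pow_lt_one₀ h0.le h1 (by norm_num))
  induction s with
  | zero =>
    simp only [zero_add, Finset.sum_range_one, le_div_iff₀ hq]
    refine (mul_le_of_le_one_right (Nat.cast_nonneg _) ?_).trans (batch_le h0 h1 hN 0)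
    have : 0 ≤ (1 - P.γ) ^ 4 := by positivity
    linarith
  | succ s ih =>
    rw [Finset.sum_range_succ]
    refine (add_le_add ih (batch_le h0 h1 hN (s + 1))).trans (le_of_eq ?_)
    rw [show 4 * (s + 1) = 4 * s + 4 by ring, pow_add]
    generalize (1 - P.γ) ^ (4 * s) = a
    have hp : (1 - P.γ) ^ 4 ≠ 0 := by positivity
    generalize (1 - P.γ) ^ 4 = b at *
    have := hq.ne'
    by_cases ha : a = 0
    · simp [ha]
    field_simp
    ring

/-- A time period is at most proportional to the batch size of its epoch. -/
theorem le_mul_batch_epoch (h0 : 0 < 1 - P.γ) (h1 : 1 - P.γ < 1) (hN : 1 ≤ P.N₀) (hd : 1 ≤ d)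
    (t : ℕ) : (t : ℝ) ≤ 4 * d / (1 - (1 - P.γ) ^ 4) * P.batch (P.epoch d t) := by
  have hq : 0 < 1 - (1 - P.γ) ^ 4 := sub_pos.mpr (pow_lt_one₀ h0.le h1 (by norm_num))
  set s := P.epoch d t
  have h2 : t ≤ ∑ i ∈ Finset.range (s + 1), d * (2 * P.batch i) := by
    have : t < 1 + ∑ i ∈ Finset.range (s + 1), d * (2 * P.batch i) :=
      lt_epochStart_epoch_succ h0 h1 hN hd t
    omega
  have h3 : (t : ℝ) ≤ 2 * d * ∑ i ∈ Finset.range (s + 1), (P.batch i : ℝ) := by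
    rw [Finset.mul_sum]
    refine (Nat.cast_le.mpr h2).trans (le_of_eq ?_)
    push_cast
    exact Finset.sum_congr rfl fun i _ => by ring
  have h4 := le_batch (P := P) s
  calc (t : ℝ) ≤ 2 * d * (2 * P.N₀ * ((1 - P.γ) ^ (4 * s))⁻¹ / (1 - (1 - P.γ) ^ 4)) := by
        refine h3.trans ?_
        gcongr
        exact sum_batch_le h0 h1 hN s
    _ = 4 * d / (1 - (1 - P.γ) ^ 4) * (((1 - P.γ) ^ (4 * s))⁻¹ * P.N₀) := by ring
    _ ≤ _ := by gcongr

theorem two_mul_batch_lt_of_lt (hd : 1 ≤ d) {s t : ℕ}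
    (h : P.epochStart d (s + 1) ≤ t) : 2 * P.batch s < t := by
  rw [epochStart_succ] at h
  have h1 : 1 ≤ P.epochStart d s := by rw [epochStart]; omega
  have := Nat.mul_le_mul_right (2 * P.batch s) hd
  omega

/-- The number of epochs that start before a time is at most logarithmic. -/
theorem epoch_le_log (h0 : 0 < 1 - P.γ) (h1 : 1 - P.γ < 1) (hN : 1 ≤ P.N₀) (hd : 1 ≤ d)
    {s t : ℕ} (h : P.epochStart d s ≤ t) :
    (s : ℝ) ≤ 1 + Real.log t / (4 * Real.log (1 - P.γ)⁻¹) := by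
  have hl : 0 < Real.log (1 - P.γ)⁻¹ := Real.log_pos ((one_lt_inv₀ h0).mpr h1)
  rcases s with _ | s
  · simp only [Nat.cast_zero]
    have := Real.log_natCast_nonneg t
    positivity
  -- The previous epoch is complete, so its batch, which is exponentially large in its index, is
  -- below `t`.
  · have h2 := two_mul_batch_lt_of_lt hd h
    have h3 : ((1 - P.γ) ^ (4 * s))⁻¹ ≤ t :=
      (inv_pow_le_batch h0 hN s).trans (by exact_mod_cast (by omega : P.batch s ≤ t))
    have h4 := Real.log_le_log (by positivity) h3
    rw [← inv_pow, Real.log_pow] at h4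
    push_cast at h4 ⊢
    rw [add_comm, add_le_add_iff_left, le_div_iff₀ (by positivity)]
    linarith

theorem norm_coordinate_le (j : ℕ) :
    ‖(WithLp.toLp 2 fun k : Fin d => if (k : ℕ) = j then 1 else 0 : Vec d)‖ ≤ 1 := by
  by_cases h : j < d
  · have : (WithLp.toLp 2 fun k : Fin d => if (k : ℕ) = j then 1 else 0 : Vec d) =
        EuclideanSpace.single ⟨j, h⟩ 1 := by
      ext k
      simp [Fin.ext_iff]
    simp [this]
  · have : (WithLp.toLp 2 fun k : Fin d => if (k : ℕ) = j then 1 else 0 : Vec d) = 0 := by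
      ext k
      have := k.2
      simp only [PiLp.zero_apply, ite_eq_right_iff]
      omega
    simp [this]

theorem norm_query_sub_center_le (X : Set (Vec d)) (z₀ : Vec d) (y : ℕ → ℝ) (t : ℕ) :
    ‖P.query X z₀ y t - P.center X z₀ y (P.epoch d t)‖ ≤ P.radius (P.epoch d t) := by
  have h := mul_le_of_le_one_right (radius_nonneg (P := P) (P.epoch d t))
    (norm_coordinate_le (d := d) ((t - P.epochStart d (P.epoch d t)) /
      (2 * P.batch (P.epoch d t))))
  rw [query]
  simp only
  split_ifs
  · rwa [add_sub_cancel_left, norm_smul, Real.norm_of_nonneg (radius_nonneg _)]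
  · rwa [sub_sub_cancel_left, norm_neg, norm_smul, Real.norm_of_nonneg (radius_nonneg _)]

theorem blockStart_add_lt (s : ℕ) {j i : ℕ} (hj : j < d) (hi : i < 2 * P.batch s) :
    P.blockStart d s j + i < P.epochStart d (s + 1) := by
  rw [epochStart_succ, blockStart]
  have := Nat.mul_le_mul_right (2 * P.batch s) (show j + 1 ≤ d from hj)
  rw [add_mul, one_mul] at this
  omega

theorem epoch_blockStart_add (h0 : 0 < 1 - P.γ) (h1 : 1 - P.γ < 1) (hN : 1 ≤ P.N₀) (hd : 1 ≤ d)
    (s : ℕ) {j i : ℕ} (hj : j < d) (hi : i < 2 * P.batch s) :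
    P.epoch d (P.blockStart d s j + i) = s :=
  epoch_eq h0 h1 hN hd (by rw [blockStart]; omega) (blockStart_add_lt s hj hi)

theorem query_blockStart_add (h0 : 0 < 1 - P.γ) (h1 : 1 - P.γ < 1) (hN : 1 ≤ P.N₀) (hd : 1 ≤ d)
    (X : Set (Vec d)) (z₀ : Vec d) (y : ℕ → ℝ) (s : ℕ) (j : Fin d) {i : ℕ}
    (hi : i < 2 * P.batch s) :
    P.query X z₀ y (P.blockStart d s j + i) = P.center X z₀ y s +
      ((-1) ^ i * P.radius s) • EuclideanSpace.single j 1 := by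
  have hj : (P.blockStart d s j + i - P.epochStart d s) / (2 * P.batch s) = j := by
    rw [blockStart, add_assoc, Nat.add_sub_cancel_left, mul_comm,
      Nat.mul_add_div (by omega), Nat.div_eq_of_lt hi, add_zero]
  have he : (WithLp.toLp 2 fun k : Fin d => if (k : ℕ) = j then 1 else 0 : Vec d) =
      EuclideanSpace.single j 1 := by
    ext k
    simp [Fin.ext_iff]
  rw [query]
  simp only [epoch_blockStart_add h0 h1 hN hd s j.2 hi, hj, he, Nat.add_sub_cancel_left]
  split_ifs with hev
  · rw [hev.neg_one_pow, one_mul]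
  · rw [(Nat.not_even_iff_odd.mp hev).neg_one_pow, neg_one_mul, neg_smul, sub_eq_add_neg]

end Schedule

end Params

/-! ### Variation of the rewards and their maximizers. -/

section Domain

variable {d : ℕ} {X : Set (Vec d)} {f : ℕ → Vec d → ℝ} {T : ℕ} {B L σ c₀ : ℝ}

theorem supDist_nonneg (g h : Vec d → ℝ) : 0 ≤ supDist X g h :=
  Real.iSup_nonneg fun _ => abs_nonneg _

theorem variation_nonneg (s t : ℕ) : 0 ≤ variation X f s t :=
  Finset.sum_nonneg fun _ _ => supDist_nonneg _ _

theorem variation_mono {s t u : ℕ} (h : t ≤ u) : variation X f s t ≤ variation X f s u :=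
  Finset.sum_le_sum_of_subset_of_nonneg (Finset.Ico_subset_Ico le_rfl h)
    fun _ _ _ => supDist_nonneg _ _

theorem Assumptions.abs_sub_le_supDist (hA : Assumptions X f T B L σ c₀) {s t : ℕ}
    (hs : s ∈ Finset.Icc 1 T) (ht : t ∈ Finset.Icc 1 T) {x : Vec d} (hx : x ∈ X) :
    |f s x - f t x| ≤ supDist X (f s) (f t) := by
  refine le_ciSup (f := fun x : X => |f s x - f t x|) ⟨2, ?_⟩ ⟨x, hx⟩
  rintro _ ⟨w, rfl⟩
  have h1 := hA.bounded s hs w w.2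
  have h2 := hA.bounded t ht w w.2
  exact (abs_sub _ _).trans (by linarith)

theorem Assumptions.abs_sub_le_variation (hA : Assumptions X f T B L σ c₀) {t : ℕ}
    (ht : t ∈ Finset.Icc 1 T) {x : Vec d} (hx : x ∈ X) :
    |f t x - f 1 x| ≤ variation X f 1 t := by
  obtain ⟨h1, hT⟩ := Finset.mem_Icc.mp ht
  induction t, h1 using Nat.le_induction with
  | base => simpa using variation_nonneg (X := X) (f := f) 1 1
  | succ t h1 ih =>
    have ht' : t ∈ Finset.Icc 1 T := Finset.mem_Icc.mpr ⟨h1, by omega⟩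
    have e1 := ih ht' (by omega)
    have e2 := hA.abs_sub_le_supDist ht ht' hx
    rw [variation, Finset.sum_Ico_succ_top h1]
    have e3 := abs_sub_le (f (t + 1) x) (f t x) (f 1 x)
    rw [variation] at e1
    linarith

theorem Assumptions.exists_maximizer (hA : Assumptions X f T B L σ c₀) (hc₀ : 0 < c₀) {t : ℕ}
    (ht : t ∈ Finset.Icc 1 T) : ∃ x ∈ innerPart X c₀,
      fderivWithin ℝ (f t) X x = 0 ∧ maxValue X (f t) = f t x := by
  obtain ⟨x, hx, hmax⟩ := hA.compact.exists_isMaxOn hA.nonempty (hA.smooth t ht).continuousOn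
  have hin := hA.interior_max t ht x hx hmax
  have hint := innerPart_subset_interior hc₀ hin
  have hnhds := mem_interior_iff_mem_nhds.mp hint
  refine ⟨x, hin, ?_, ?_⟩
  · rw [fderivWithin_of_mem_nhds hnhds]
    exact (hmax.isLocalMax hnhds).fderiv_eq_zero
  · have : Nonempty X := ⟨⟨x, hx⟩⟩
    refine le_antisymm (ciSup_le fun w => hmax w.2) ?_
    refine le_ciSup (f := fun w : X => f t w) ⟨f t x, ?_⟩ ⟨x, hx⟩
    rintro _ ⟨w, rfl⟩
    exact hmax w.2

end Domain

/-! ### Deterministic analysis of a run: gradient error and one ascent step. -/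

/-- Writes `u₊ - u₋` as one signed sum over consecutive times, the form to which concentration
applies. -/
theorem sum_even_sub_sum_odd (g : ℕ → ℝ) (n : ℕ) :
    ∑ i ∈ Finset.range n, g (2 * i) - ∑ i ∈ Finset.range n, g (2 * i + 1) =
      ∑ k ∈ Finset.range (2 * n), (-1) ^ k * g k := by
  induction n with
  | zero => simp
  | succ n ih =>
    rw [Finset.sum_range_succ, Finset.sum_range_succ, show 2 * (n + 1) = 2 * n + 1 + 1 by ring,
      Finset.sum_range_succ, Finset.sum_range_succ, ← ih, pow_succ, pow_mul]
    norm_num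
    ring

/-- A run of the algorithm up to time `t`, with observations `y` that have conditional means `m`
and deviate from them, along the prefixes and the blocks, by at most `K` times the square root of
the number of summands. -/
structure Run {d : ℕ} (P : Params) (X : Set (Vec d)) (f : ℕ → Vec d → ℝ) (T t : ℕ)
    (B L σ K : ℝ) (z₀ : Vec d) (y m : ℕ → ℝ) : Prop where
  dim_pos : 1 ≤ d
  sigma_pos : 0 < σ
  sigma_lt : σ < L
  c₀_pos : 0 < P.c₀
  gamma_eq : P.γ = σ / L
  eta_eq : P.η₀ = 1 / L
  one_le_N₀ : 1 ≤ P.N₀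
  assumptions : Assumptions X f T B L σ P.c₀
  start_mem : z₀ ∈ innerPart X P.c₀
  one_le : 1 ≤ t
  le_horizon : t ≤ T
  K_nonneg : 0 ≤ K
  variation_le : variation X f 1 t ≤ 1 / √t
  mean_le : ∀ r ∈ Finset.Icc 1 t, |m r| ≤ 1
  mean_eq : ∀ r ∈ Finset.Icc 1 t, P.query X z₀ y r ∈ X → m r = f r (P.query X z₀ y r)
  prefix_le : ∀ r ∈ Finset.Icc 1 t, |∑ k ∈ Finset.Icc 1 r, (y k - m k)| ≤ K * √r
  block_le : ∀ s, P.epochStart d (s + 1) ≤ t → ∀ j : Fin d,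
    |∑ k ∈ Finset.range (2 * P.batch s),
      (-1) ^ k * (y (P.blockStart d s j + k) - m (P.blockStart d s j + k))| ≤
      K * √(2 * P.batch s : ℕ)

namespace Run

variable {d : ℕ} {P : Params} {X : Set (Vec d)} {f : ℕ → Vec d → ℝ} {T t : ℕ}
    {B L σ K : ℝ} {z₀ : Vec d} {y m : ℕ → ℝ}

theorem L_pos (h : Run P X f T t B L σ K z₀ y m) : 0 < L := h.sigma_pos.trans h.sigma_lt

theorem one_sub_gamma_pos (h : Run P X f T t B L σ K z₀ y m) : 0 < 1 - P.γ := by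
  rw [h.gamma_eq, sub_pos, div_lt_one h.L_pos]
  exact h.sigma_lt

theorem one_sub_gamma_lt_one (h : Run P X f T t B L σ K z₀ y m) : 1 - P.γ < 1 := by
  rw [h.gamma_eq, sub_lt_self_iff]
  exact div_pos h.sigma_pos h.L_pos

theorem batch_pos (h : Run P X f T t B L σ K z₀ y m) (s : ℕ) : 0 < P.batch s :=
  Params.batch_pos h.one_sub_gamma_pos h.one_sub_gamma_lt_one h.one_le_N₀ s

theorem isClosed_innerPart (h : Run P X f T t B L σ K z₀ y m) : IsClosed (innerPart X P.c₀) :=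
  Bandit.isClosed_innerPart h.assumptions.compact.isClosed

theorem nonempty_interior (h : Run P X f T t B L σ K z₀ y m) : (interior X).Nonempty :=
  ⟨z₀, innerPart_subset_interior h.c₀_pos h.start_mem⟩

theorem center_mem (h : Run P X f T t B L σ K z₀ y m) (s : ℕ) :
    P.center X z₀ y s ∈ innerPart X P.c₀ := by
  cases s with
  | zero => exact h.start_mem
  | succ s => exact (proj_spec h.isClosed_innerPart ⟨z₀, h.start_mem⟩ _).1

theorem query_mem (h : Run P X f T t B L σ K z₀ y m) {r : ℕ}
    (hr : P.radius (P.epoch d r) ≤ P.c₀) : P.query X z₀ y r ∈ X := by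
  have := mem_innerPart_iff.mp (h.center_mem (P.epoch d r)) _
    ((P.norm_query_sub_center_le X z₀ y r).trans hr)
  simpa using this

theorem mem_Icc_horizon (h : Run P X f T t B L σ K z₀ y m) {r : ℕ} (hr : r ∈ Finset.Icc 1 t) :
    r ∈ Finset.Icc 1 T :=
  Finset.Icc_subset_Icc le_rfl h.le_horizon hr

theorem one_mem (h : Run P X f T t B L σ K z₀ y m) : 1 ∈ Finset.Icc 1 T :=
  h.mem_Icc_horizon (Finset.mem_Icc.mpr ⟨le_rfl, h.one_le⟩)

theorem abs_sub_le_variation (h : Run P X f T t B L σ K z₀ y m) {r : ℕ}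
    (hr : r ∈ Finset.Icc 1 t) {x : Vec d} (hx : x ∈ X) :
    |f r x - f 1 x| ≤ variation X f 1 t :=
  (h.assumptions.abs_sub_le_variation (h.mem_Icc_horizon hr) hx).trans
    (variation_mono (Finset.mem_Icc.mp hr).2)

theorem blockStart_add_mem {s k : ℕ} (hs : P.epochStart d (s + 1) ≤ t) (j : Fin d)
    (hk : k < 2 * P.batch s) : P.blockStart d s j + k ∈ Finset.Icc 1 t := by
  have h1 := P.blockStart_add_lt s j.2 hk
  have h2 : 1 ≤ P.blockStart d s j := by
    rw [Params.blockStart, Params.epochStart]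
    omega
  exact Finset.mem_Icc.mpr ⟨by omega, by omega⟩

/-- The error of the gradient estimate of a completed epoch, with respect to the gradient of
`f 1`. -/
theorem abs_gradEst_sub_le (h : Run P X f T t B L σ K z₀ y m) {s : ℕ}
    (hs : P.epochStart d (s + 1) ≤ t) (hδ : P.radius s ≤ P.c₀) (j : Fin d) :
    |P.gradEst (d := d) y s j - fderivWithin ℝ (f 1) X (P.center X z₀ y s)
      (EuclideanSpace.single j 1)| ≤ (K + 1 + L) * P.radius s := by
  have h0 := h.one_sub_gamma_pos
  have h1 := h.one_sub_gamma_lt_one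
  have hL := h.L_pos
  set z := P.center X z₀ y s with hz
  set e : Vec d := EuclideanSpace.single j 1 with he
  set b := P.blockStart d s j with hb
  set n := P.batch s with hn
  set δ := P.radius s with hδdef
  set g := fderivWithin ℝ (f 1) X z e with hg
  have hnpos : (0 : ℝ) < n := by exact_mod_cast h.batch_pos s
  have hδpos : 0 < δ := P.radius_pos h0 h1 h.one_le_N₀ s
  have hδ2 : δ ^ 2 = (√(n : ℝ))⁻¹ := P.radius_sq s
  have hnδ : n * δ ^ 2 = √(n : ℝ) := by
    rw [hδ2, ← div_eq_mul_inv, Real.div_sqrt]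
  have hzX : z ∈ X := innerPart_subset h.c₀_pos.le (h.center_mem s)
  have hnt : 2 * n < t := P.two_mul_batch_lt_of_lt h.dim_pos hs
  -- The epoch is complete, so `n ≤ t` and the drift `1/√t` is at most `1/√n = δ²`.
  have hΔ : variation X f 1 t ≤ δ ^ 2 := by
    refine h.variation_le.trans ?_
    rw [hδ2, one_div]
    have : (n : ℝ) ≤ t := by exact_mod_cast (by omega : n ≤ t)
    gcongr
  have hmean : ∀ k ∈ Finset.range (2 * n),
      |(-1) ^ k * m (b + k) - ((-1) ^ k * f 1 z + δ * g)| ≤ δ ^ 2 + L * δ ^ 2 := by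
    intro k hk
    have hk := Finset.mem_range.mp hk
    have hmem := blockStart_add_mem hs j hk
    have hq := P.query_blockStart_add h0 h1 h.one_le_N₀ h.dim_pos X z₀ y s j hk
    have hqX : P.query X z₀ y (b + k) ∈ X := by
      refine h.query_mem ?_
      rwa [P.epoch_blockStart_add h0 h1 h.one_le_N₀ h.dim_pos s j.2 hk]
    have e1 := h.abs_sub_le_variation hmem hqX
    have e2 := abs_sub_sub_fderivWithin_le h.assumptions.convex h.nonempty_interior
      (h.assumptions.smooth 1 h.one_mem) hL.le (h.assumptions.hess_le 1 h.one_mem) hzX hqX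
    have hsgn : |(-1 : ℝ) ^ k| = 1 := by simp
    rw [← hb] at hq
    have hsub : P.query X z₀ y (b + k) - z = ((-1) ^ k * δ) • e := by
      rw [hq, add_sub_cancel_left]
    rw [hsub, norm_smul, map_smul, smul_eq_mul, norm_mul, Real.norm_eq_abs, hsgn,
      Real.norm_of_nonneg hδpos.le, he, PiLp.norm_single, norm_one, one_mul,
      mul_one] at e2
    rw [h.mean_eq _ hmem hqX]
    set Q := P.query X z₀ y (b + k)
    have hsq : (-1 : ℝ) ^ k * (-1) ^ k = 1 := by rw [← mul_pow]; simp
    have : (-1) ^ k * f (b + k) Q - ((-1) ^ k * f 1 z + δ * g) =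
        (-1) ^ k * ((f (b + k) Q - f 1 Q) + (f 1 Q - f 1 z - (-1) ^ k * δ * g)) := by
      linear_combination (δ * g) * hsq
    rw [this, abs_mul, hsgn, one_mul]
    exact (abs_add_le _ _).trans (add_le_add (e1.trans hΔ) e2)
  -- The alternation cancels the common value `f 1 z`, leaving only the directional derivative.
  have halt : ∑ k ∈ Finset.range (2 * n), (-1 : ℝ) ^ k = 0 := by
    simp
  have hmsum : |∑ k ∈ Finset.range (2 * n), (-1) ^ k * m (b + k) - 2 * n * (δ * g)| ≤
      2 * n * (δ ^ 2 + L * δ ^ 2) := by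
    have e1 : ∑ k ∈ Finset.range (2 * n), (-1) ^ k * m (b + k) - 2 * n * (δ * g) =
        ∑ k ∈ Finset.range (2 * n), ((-1) ^ k * m (b + k) - ((-1) ^ k * f 1 z + δ * g)) := by
      rw [Finset.sum_sub_distrib, Finset.sum_add_distrib, ← Finset.sum_mul, halt]
      simp
    rw [e1]
    refine (Finset.abs_sum_le_sum_abs _ _).trans ((Finset.sum_le_sum hmean).trans (le_of_eq ?_))
    rw [Finset.sum_const, Finset.card_range, nsmul_eq_mul]
    push_cast
    ring
  have hnoise := h.block_le s hs j
  have hsqrt : √((2 * n : ℕ) : ℝ) ≤ 2 * √(n : ℝ) := by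
    rw [Real.sqrt_le_left (by positivity), mul_pow, Real.sq_sqrt hnpos.le]
    push_cast
    linarith
  have hy : |∑ k ∈ Finset.range (2 * n), (-1) ^ k * y (b + k) - 2 * n * (δ * g)| ≤
      2 * n * ((K + 1 + L) * δ ^ 2) := by
    have e1 : ∑ k ∈ Finset.range (2 * n), (-1) ^ k * y (b + k) - 2 * n * (δ * g) =
        ∑ k ∈ Finset.range (2 * n), (-1) ^ k * (y (b + k) - m (b + k)) +
        (∑ k ∈ Finset.range (2 * n), (-1) ^ k * m (b + k) - 2 * n * (δ * g)) := by
      simp only [mul_sub, Finset.sum_sub_distrib]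
      ring
    rw [e1]
    refine (abs_add_le _ _).trans ((add_le_add hnoise hmsum).trans ?_)
    have := mul_le_mul_of_nonneg_left hsqrt h.K_nonneg
    rw [← hnδ] at this
    linarith
  have hgrad : P.gradEst (d := d) y s j =
      (∑ k ∈ Finset.range (2 * n), (-1) ^ k * y (b + k)) / (2 * δ * n) := by
    rw [← sum_even_sub_sum_odd (fun k => y (b + k)) n]
    rfl
  have hden : 0 < 2 * δ * n := by positivity
  have e2 : P.gradEst (d := d) y s j - g =
      (∑ k ∈ Finset.range (2 * n), (-1) ^ k * y (b + k) - 2 * n * (δ * g)) / (2 * δ * n) := by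
    rw [hgrad]
    field_simp
  rw [e2, abs_div, abs_of_pos hden, div_le_iff₀ hden]
  linarith

theorem norm_center_succ_sub_le (h : Run P X f T t B L σ K z₀ y m) {x : Vec d}
    (hx : x ∈ innerPart X P.c₀) (hx0 : fderivWithin ℝ (f 1) X x = 0) {s : ℕ}
    (hs : P.epochStart d (s + 1) ≤ t) (hδ : P.radius s ≤ P.c₀) :
    ‖P.center X z₀ y (s + 1) - x‖ ≤ (1 - P.γ) * ‖P.center X z₀ y s - x‖ +
      d / L * (K + 1 + L) * P.radius s := by
  have hL := h.L_pos
  have hK := h.K_nonneg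
  rw [Params.center, h.eta_eq]
  refine (norm_proj_sub_le h.isClosed_innerPart (convex_innerPart h.assumptions.convex) _ hx).trans
    ?_
  set z := P.center X z₀ y s
  set G : Vec d := P.gradEst y s
  set v := z + (1 / L : ℝ) • G - x with hv
  set ε := (K + 1 + L) * P.radius s with hε
  have hε0 : 0 ≤ ε := mul_nonneg (by positivity) (P.radius_nonneg s)
  have hcoord : ∀ j, |v j| ≤ ‖v‖ := fun j => by
    simpa using PiLp.norm_apply_le v j
  have hf' : fderivWithin ℝ (f 1) X z v =
      ∑ j, v j * fderivWithin ℝ (f 1) X z (EuclideanSpace.single j 1) := by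
    have : v = ∑ j, v j • EuclideanSpace.single j (1 : ℝ) := by
      ext k
      simp [Finset.sum_apply, Pi.single_apply]
    conv_lhs => rw [this]
    simp
  -- Each coordinate of `v` is bounded crudely by `‖v‖`, whence the factor `d`.
  have hinner : inner ℝ v G ≤ fderivWithin ℝ (f 1) X z v + d * (‖v‖ * ε) := by
    rw [hf', PiLp.inner_apply]
    have hj : ∀ j ∈ Finset.univ, inner ℝ (v j) (G j) ≤
        v j * fderivWithin ℝ (f 1) X z (EuclideanSpace.single j 1) + ‖v‖ * ε := by
      intro j _
      have e1 := h.abs_gradEst_sub_le hs hδ j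
      have e2 : v j * (G j - fderivWithin ℝ (f 1) X z (EuclideanSpace.single j 1)) ≤ ‖v‖ * ε := by
        refine (le_abs_self _).trans ?_
        rw [abs_mul]
        exact mul_le_mul (hcoord j) e1 (abs_nonneg _) (norm_nonneg _)
      have e3 : inner ℝ (v j) (G j) = v j * G j := by simp [mul_comm]
      rw [e3]
      linarith
    refine (Finset.sum_le_sum hj).trans (le_of_eq ?_)
    rw [Finset.sum_add_distrib]
    simp
  have hcontr := abs_inner_add_fderivWithin_sub_le h.assumptions.convex h.nonempty_interior
    (h.assumptions.smooth 1 h.one_mem) hL h.sigma_lt.le (h.assumptions.hess_le 1 h.one_mem)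
    (h.assumptions.strong_concave 1 h.one_mem) (innerPart_subset h.c₀_pos.le hx)
    (innerPart_subset h.c₀_pos.le (h.center_mem s)) v
  rw [hx0, ← h.gamma_eq] at hcontr
  have hc := (abs_le.mp hcontr).2
  simp only [zero_apply, sub_zero] at hc
  have hsq : ‖v‖ * ‖v‖ = inner ℝ v (z - x) + 1 / L * inner ℝ v G := by
    rw [← real_inner_self_eq_norm_mul_norm]
    conv_lhs => rw [show inner ℝ v v = inner ℝ v ((z - x) + (1 / L : ℝ) • G) by
      congr 1; rw [hv]; abel]
    rw [inner_add_right, inner_smul_right]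
  have h5 := mul_le_mul_of_nonneg_left hinner (show 0 ≤ 1 / L by positivity)
  -- Pairing `v` with itself brings in the contraction; dividing by `‖v‖` finishes.
  have key : ‖v‖ * ‖v‖ ≤ ‖v‖ * ((1 - P.γ) * ‖z - x‖ + d / L * ε) := by
    have : ‖v‖ * ((1 - P.γ) * ‖z - x‖ + d / L * ε) =
        (1 - P.γ) * ‖v‖ * ‖z - x‖ + 1 / L * (d * (‖v‖ * ε)) := by ring
    rw [this]
    linarith
  rw [mul_assoc]
  rcases (norm_nonneg v).eq_or_lt with h0 | h0
  · rw [← h0]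
    have := h.one_sub_gamma_pos
    positivity
  · exact le_of_mul_le_mul_left key h0

end Run

/-! ### Regret of the queries and the two bounds along a run. -/

theorem sum_inv_sqrt_le (n : ℕ) : ∑ k ∈ Finset.Icc 1 n, (√(k : ℝ))⁻¹ ≤ 2 * √(n : ℝ) := by
  induction n with
  | zero => simp
  | succ n ih =>
    rw [Finset.sum_Icc_succ_top (by omega)]
    have h1 : 0 < √((n + 1 : ℕ) : ℝ) := Real.sqrt_pos.mpr (by positivity)
    have h2 : (√((n + 1 : ℕ) : ℝ))⁻¹ ≤ 2 * (√((n + 1 : ℕ) : ℝ) - √(n : ℝ)) := by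
      rw [inv_le_iff_one_le_mul₀ h1]
      have e1 : √((n + 1 : ℕ) : ℝ) ^ 2 = n + 1 := by
        rw [Real.sq_sqrt (by positivity)]; push_cast; ring
      have e2 : √(n : ℝ) ^ 2 = n := Real.sq_sqrt (by positivity)
      nlinarith [sq_nonneg (√((n + 1 : ℕ) : ℝ) - √(n : ℝ))]
    linarith

/-- A bound for the distance of the centre of epoch `s` from the maximizer of `f 1`, divided by
`(1 - γ) ^ s`. The parameter `s₀` is an epoch from which on the queries stay in the domain. -/
noncomputable def distBound (d s₀ : ℕ) (p B L K s : ℝ) : ℝ :=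
  B * (p ^ s₀)⁻¹ + s * (d / L * (K + 1 + L) / p)

/-- The constant of the bound of order `1 / √t` for the regret of the query at time `t`. -/
noncomputable def regretBound (d s₀ : ℕ) (p B L K N n₀ s : ℝ) : ℝ :=
  (2 * L * (√(2 * N) * distBound d s₀ p B L K s ^ 2 + 1) + 2 * √n₀) * √(4 * d / (1 - p ^ 4))

namespace Run

variable {d : ℕ} {P : Params} {X : Set (Vec d)} {f : ℕ → Vec d → ℝ} {T t s₀ : ℕ}
    {B L σ K : ℝ} {z₀ x : Vec d} {y m : ℕ → ℝ}

/-- Up to epoch `s₀` only the diameter bound is used, which costs `(1-γ)^(-s₀)`. From then on `δ_s ≤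
c₀` keeps the queries in `X`. Contraction and error decay at the same rate, so each epoch adds a
fixed amount in units of `(1-γ)^s`. -/
theorem norm_center_sub_le (h : Run P X f T t B L σ K z₀ y m)
    (hs₀ : (1 - P.γ) ^ s₀ ≤ P.c₀) (hx : x ∈ innerPart X P.c₀)
    (hx0 : fderivWithin ℝ (f 1) X x = 0) {s : ℕ} (hs : P.epochStart d s ≤ t) :
    ‖P.center X z₀ y s - x‖ ≤ (1 - P.γ) ^ s * distBound d s₀ (1 - P.γ) B L K s := by
  have hp := h.one_sub_gamma_pos
  have hp1 := h.one_sub_gamma_lt_one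
  have hL := h.L_pos
  have hK := h.K_nonneg
  have hxX : x ∈ X := innerPart_subset h.c₀_pos.le hx
  have hB : 0 ≤ B := (norm_nonneg _).trans (h.assumptions.diam_le x hxX x hxX)
  have early : ∀ s ≤ s₀,
      ‖P.center X z₀ y s - x‖ ≤ (1 - P.γ) ^ s * distBound d s₀ (1 - P.γ) B L K s := by
    intro s hs
    refine (h.assumptions.diam_le _ (innerPart_subset h.c₀_pos.le (h.center_mem s)) x hxX).trans ?_
    have e1 : (1 - P.γ) ^ s₀ ≤ (1 - P.γ) ^ s := pow_le_pow_of_le_one hp.le hp1.le hs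
    have e2 : B ≤ (1 - P.γ) ^ s * (B * ((1 - P.γ) ^ s₀)⁻¹) := by
      rw [← div_eq_mul_inv, mul_div_assoc', le_div_iff₀ (by positivity), mul_comm]
      gcongr
    refine e2.trans ?_
    rw [distBound]
    gcongr
    have : 0 ≤ (s : ℝ) * (d / L * (K + 1 + L) / (1 - P.γ)) := by positivity
    linarith
  induction s with
  | zero => exact early 0 (Nat.zero_le _)
  | succ s ih =>
    rcases Nat.lt_or_ge s s₀ with hlt | hge
    · exact early (s + 1) hlt
    · have e1 := P.radius_le_pow hp h.one_le_N₀ s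
      have e2 : P.radius s ≤ P.c₀ :=
        e1.trans ((pow_le_pow_of_le_one hp.le hp1.le hge).trans hs₀)
      refine (h.norm_center_succ_sub_le hx hx0 hs e2).trans ?_
      have e3 := ih ((Params.epochStart_mono (Nat.le_succ s)).trans hs)
      calc _ ≤ (1 - P.γ) * ((1 - P.γ) ^ s * distBound d s₀ (1 - P.γ) B L K s) +
            d / L * (K + 1 + L) * (1 - P.γ) ^ s := by gcongr
        _ = _ := by
          rw [distBound, distBound]
          push_cast
          generalize d / L * (K + 1 + L) = M
          field_simp
          ring

/-- The regret of a query, with respect to the maximum of `f 1`. -/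
theorem abs_sub_mean_le (h : Run P X f T t B L σ K z₀ y m)
    (hs₀ : (1 - P.γ) ^ s₀ ≤ P.c₀) (hx : x ∈ innerPart X P.c₀)
    (hx0 : fderivWithin ℝ (f 1) X x = 0) {r : ℕ}
    (hr : r ∈ Finset.Icc 1 t) :
    |f 1 x - m r| ≤ variation X f 1 t +
      regretBound d s₀ (1 - P.γ) B L K P.N₀ (P.batch s₀)
        (1 + Real.log T / (4 * Real.log (1 - P.γ)⁻¹)) * (√(r : ℝ))⁻¹ := by
  have hp := h.one_sub_gamma_pos
  have hp1 := h.one_sub_gamma_lt_one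
  have hL := h.L_pos
  have hK := h.K_nonneg
  obtain ⟨hr1, hrt⟩ := Finset.mem_Icc.mp hr
  have hxX : x ∈ X := innerPart_subset h.c₀_pos.le hx
  have hB : 0 ≤ B := (norm_nonneg _).trans (h.assumptions.diam_le x hxX x hxX)
  set s := P.epoch d r with hs
  set n : ℝ := (P.batch s : ℝ) with hn
  set S := 1 + Real.log T / (4 * Real.log (1 - P.γ)⁻¹) with hS
  have hnpos : 0 < n := Nat.cast_pos.mpr (h.batch_pos s)
  have hstart : P.epochStart d s ≤ r := Params.epochStart_epoch_le hr1
  have hsS : (s : ℝ) ≤ S := Params.epoch_le_log hp hp1 h.one_le_N₀ h.dim_pos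
    (hstart.trans (hrt.trans h.le_horizon))
  have hrate : (√n)⁻¹ ≤ √(4 * d / (1 - (1 - P.γ) ^ 4)) * (√(r : ℝ))⁻¹ := by
    have hrpos : 0 < √(r : ℝ) := Real.sqrt_pos.mpr (by exact_mod_cast hr1)
    have e1 := Real.sqrt_le_sqrt (P.le_mul_batch_epoch hp hp1 h.one_le_N₀ h.dim_pos r)
    rw [Real.sqrt_mul' _ hnpos.le] at e1
    rw [← div_eq_mul_inv, le_div_iff₀ hrpos, mul_comm, ← div_eq_mul_inv,
      div_le_iff₀ (Real.sqrt_pos.mpr hnpos)]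
    exact e1
  set D := distBound d s₀ (1 - P.γ) B L K S with hD
  have hmain : |f 1 x - m r| ≤ variation X f 1 t +
      (2 * L * (√(2 * P.N₀) * D ^ 2 + 1) + 2 * √(P.batch s₀ : ℝ)) * (√n)⁻¹ := by
    -- Before epoch `s₀` queries may leave `X` and the mean is only known to be bounded by `1`. The
    -- trivial bound `2` is absorbed by the term with `P.batch s₀`.
    rcases Nat.lt_or_ge s s₀ with hlt | hge
    · have e1 : |f 1 x - m r| ≤ 2 := by
        have := h.assumptions.bounded 1 h.one_mem x hxX
        exact (abs_sub _ _).trans (by linarith [h.mean_le r hr])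
      have e2 : n ≤ P.batch s₀ := Nat.cast_le.mpr (P.batch_mono hp hp1 hlt.le)
      have e3 : 2 ≤ 2 * √(P.batch s₀ : ℝ) * (√n)⁻¹ := by
        rw [← div_eq_mul_inv, le_div_iff₀ (Real.sqrt_pos.mpr hnpos)]
        gcongr
      have e4 : 0 ≤ 2 * L * (√(2 * P.N₀) * D ^ 2 + 1) * (√n)⁻¹ := by positivity
      rw [add_mul]
      linarith [variation_nonneg (X := X) (f := f) 1 t]
    · have e1 : P.radius s ≤ P.c₀ := (P.radius_le_pow hp h.one_le_N₀ s).trans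
        ((pow_le_pow_of_le_one hp.le hp1.le hge).trans hs₀)
      have hq := h.query_mem (r := r) e1
      rw [h.mean_eq r hr hq]
      set Q := P.query X z₀ y r
      have e2 := h.abs_sub_le_variation hr hq
      have e3 := abs_sub_sub_fderivWithin_le h.assumptions.convex h.nonempty_interior
        (h.assumptions.smooth 1 h.one_mem) hL.le (h.assumptions.hess_le 1 h.one_mem) hxX hq
      -- Stationarity of `x` makes the regret quadratic in the distance.
      rw [hx0, zero_apply, sub_zero] at e3
      have e4 : ‖Q - x‖ ≤ P.radius s + (1 - P.γ) ^ s * D := by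
        have e5 := P.norm_query_sub_center_le X z₀ y r
        have e6 := h.norm_center_sub_le hs₀ hx hx0 (hstart.trans hrt)
        have e7 : distBound d s₀ (1 - P.γ) B L K s ≤ D := by
          rw [hD, distBound, distBound]
          gcongr
        refine (norm_sub_le_norm_sub_add_norm_sub Q (P.center X z₀ y s) x).trans
          (add_le_add e5 (e6.trans ?_))
        gcongr
      have e8 : ‖Q - x‖ ^ 2 ≤ 2 * (√(2 * P.N₀) * D ^ 2 + 1) * (√n)⁻¹ := by
        have e9 := P.radius_sq s
        have e10 := mul_le_mul_of_nonneg_right (P.pow_sq_le hp hp1 h.one_le_N₀ s) (sq_nonneg D)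
        have e11 : ‖Q - x‖ ^ 2 ≤ (P.radius s + (1 - P.γ) ^ s * D) ^ 2 := by gcongr
        have e12 := sq_nonneg (P.radius s - (1 - P.γ) ^ s * D)
        rw [← hn] at e9 e10
        nlinarith
      have e13 := mul_le_mul_of_nonneg_left e8 hL.le
      have e14 : |f 1 x - f r Q| ≤ |f r Q - f 1 Q| + |f 1 Q - f 1 x| := by
        rw [abs_sub_comm]
        exact abs_sub_le _ _ _
      have e15 : 0 ≤ 2 * √(P.batch s₀ : ℝ) * (√n)⁻¹ := by positivity
      rw [add_mul]
      linarith
  refine hmain.trans ?_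
  rw [regretBound, ← hD, mul_assoc _ _ ((√(r : ℝ))⁻¹)]
  gcongr

theorem abs_sum_sub_le (h : Run P X f T t B L σ K z₀ y m) {F R : ℝ} (hR : 0 ≤ R)
    (hF : ∀ r ∈ Finset.Icc 1 t, |F - m r| ≤ variation X f 1 t + R * (√(r : ℝ))⁻¹) {r : ℕ}
    (hr : r ∈ Finset.Icc 1 t) :
    |∑ k ∈ Finset.Icc 1 r, y k - r * F| ≤ r * variation X f 1 t + (2 * R + K) * √(r : ℝ) := by
  have e1 : ∑ k ∈ Finset.Icc 1 r, y k - r * F =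
      ∑ k ∈ Finset.Icc 1 r, (y k - m k) - ∑ k ∈ Finset.Icc 1 r, (F - m k) := by
    rw [Finset.sum_sub_distrib, Finset.sum_sub_distrib]
    simp
  have e2 : |∑ k ∈ Finset.Icc 1 r, (F - m k)| ≤
      ∑ k ∈ Finset.Icc 1 r, (variation X f 1 t + R * (√(k : ℝ))⁻¹) :=
    (Finset.abs_sum_le_sum_abs _ _).trans (Finset.sum_le_sum fun k hk =>
      hF k (Finset.Icc_subset_Icc le_rfl (Finset.mem_Icc.mp hr).2 hk))
  rw [Finset.sum_add_distrib, ← Finset.mul_sum] at e2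
  simp only [Finset.sum_const, Nat.card_Icc, Nat.add_sub_cancel, nsmul_eq_mul] at e2
  have e3 := mul_le_mul_of_nonneg_left (sum_inv_sqrt_le r) hR
  rw [e1]
  refine (abs_sub _ _).trans ?_
  linarith [h.prefix_le r hr]

/-- Both parts of weak non-stationarity hold along a run, with the maximum `F` of `f 1` in place of
the minimum of the maxima. -/
theorem rbar_bounds (h : Run P X f T t B L σ K z₀ y m) {F R : ℝ} (hR : 0 ≤ R)
    (hF : ∀ r ∈ Finset.Icc 1 t, |F - m r| ≤ variation X f 1 t + R * (√(r : ℝ))⁻¹)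
    (hκ : 3 * (2 * R + K) ≤ 2 * P.κ₀) (hκ1 : 1 ≤ P.κ₀) :
    F - 6 * P.κ₀ * variation X f 1 t ≤ P.rbar y t ∧
      (1 / (t : ℝ)) * ∑ r ∈ Finset.Icc 1 t, (P.rbar y r - y r) ≤
        6 * P.κ₀ / √t + 6 * P.κ₀ * variation X f 1 t := by
  have hK := h.K_nonneg
  set V := variation X f 1 t
  have hV : 0 ≤ V := variation_nonneg 1 t
  have htpos : (0 : ℝ) < t := by exact_mod_cast h.one_le
  have hmem : t ∈ Finset.Icc 1 t := Finset.mem_Icc.mpr ⟨h.one_le, le_rfl⟩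
  have havg : ∀ r ∈ Finset.Icc 1 t,
      |(∑ k ∈ Finset.Icc 1 r, y k) / r - F| ≤ V + (2 * R + K) * (√(r : ℝ))⁻¹ := by
    intro r hr
    have hrpos : (0 : ℝ) < r := by exact_mod_cast (Finset.mem_Icc.mp hr).1
    have e1 := h.abs_sum_sub_le hR hF hr
    have e2 : (∑ k ∈ Finset.Icc 1 r, y k) / r - F = (∑ k ∈ Finset.Icc 1 r, y k - r * F) / r := by
      field_simp
    rw [e2, abs_div, abs_of_pos hrpos, div_le_iff₀ hrpos]
    have e3 : (√(r : ℝ))⁻¹ * r = √(r : ℝ) := by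
      rw [mul_comm, ← div_eq_mul_inv, Real.div_sqrt]
    rw [add_mul, mul_assoc (2 * R + K), e3]
    linarith
  have hinv : 0 ≤ (√(t : ℝ))⁻¹ := by positivity
  have hVκ : V ≤ P.κ₀ * V := le_mul_of_one_le_left hV hκ1
  have hκt := mul_le_mul_of_nonneg_right hκ hinv
  have hRK : 0 ≤ (2 * R + K) * (√(t : ℝ))⁻¹ := by positivity
  have ht := abs_le.mp (havg t hmem)
  constructor
  · rw [Params.rbar, div_eq_mul_inv (2 * P.κ₀)]
    linarith [ht.1]
  · have e1 : ∑ r ∈ Finset.Icc 1 t, P.rbar y r ≤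
        ∑ r ∈ Finset.Icc 1 t, (F + V + (2 * R + K + 2 * P.κ₀) * (√(r : ℝ))⁻¹) := by
      refine Finset.sum_le_sum fun r hr => ?_
      have := (abs_le.mp (havg r hr)).2
      rw [Params.rbar, div_eq_mul_inv (2 * P.κ₀)]
      linarith
    rw [Finset.sum_add_distrib, ← Finset.mul_sum] at e1
    simp only [Finset.sum_const, Nat.card_Icc, Nat.add_sub_cancel, nsmul_eq_mul] at e1
    have e2 := mul_le_mul_of_nonneg_left (sum_inv_sqrt_le t)
      (show 0 ≤ 2 * R + K + 2 * P.κ₀ by positivity)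
    -- Averaging `1/√r` doubles the error, and the mean reward costs `2R+K` once more: in total
    -- `3(2R+K) + 4κ₀`, which `hκ` bounds by `6κ₀`.
    have e3 : ∑ r ∈ Finset.Icc 1 t, (P.rbar y r - y r) ≤
        t * V + 2 * (2 * R + K + 2 * P.κ₀) * √(t : ℝ) + (t * F - ∑ r ∈ Finset.Icc 1 t, y r) := by
      rw [Finset.sum_sub_distrib]
      linarith
    have e4 := mul_le_mul_of_nonneg_left e3 (show 0 ≤ 1 / (t : ℝ) by positivity)
    have e5 : √(t : ℝ) / t = (√(t : ℝ))⁻¹ := by rw [Real.sqrt_div_self', one_div]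
    have e6 : 1 / (t : ℝ) * (t * V + 2 * (2 * R + K + 2 * P.κ₀) * √(t : ℝ) +
        (t * F - ∑ r ∈ Finset.Icc 1 t, y r)) =
        V + 2 * (2 * R + K + 2 * P.κ₀) * (√(t : ℝ))⁻¹ +
          (F - (∑ r ∈ Finset.Icc 1 t, y r) / t) := by
      rw [← e5]
      field_simp
    rw [div_eq_mul_inv (6 * P.κ₀)]
    linarith [ht.1]

end Run

/-! ### Comparison of the constants with `κ₀` for large `T`. -/

section Parameters

variable {d T : ℕ} {B L σ c₀ : ℝ}

theorem le_kappa (hd : 1 ≤ d) (hT : 1 ≤ T) (hL : 0 < L) (hσL : σ < L) (hc₀ : 0 < c₀) :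
    L ≤ kappa d T B L σ c₀ ∧
      2 * L ^ 2 * (d : ℝ) ^ (3 / 2 : ℝ) / (c₀ * (1 - σ / L) ^ 7) * Real.log T ^ 4 ≤
        kappa d T B L σ c₀ := by
  have hp : 0 < 1 - σ / L := by rwa [sub_pos, div_lt_one hL]
  have hlT : 0 ≤ Real.log T := Real.log_natCast_nonneg T
  have hTpos : (0 : ℝ) < T := by exact_mod_cast hT
  have hle : Real.log T ≤ Real.log (d * T) := by
    refine Real.log_le_log hTpos ?_
    exact le_mul_of_one_le_left hTpos.le (by exact_mod_cast hd)
  have hl : 0 ≤ Real.log (d * T) := hlT.trans hle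
  have h1 : 0 ≤ √(Real.log (d * T)) := Real.sqrt_nonneg _
  have h2 : 0 ≤ 2 * d * Real.log T / (1 - σ / L) := by positivity
  have h3 : 0 ≤ 16 * B ^ 2 * (d : ℝ) ^ (3 / 2 : ℝ) * Real.log (d * T) ^ 4 /
      (c₀ * (1 - σ / L) ^ 3) := by positivity
  have h4 : 2 * L ^ 2 * (d : ℝ) ^ (3 / 2 : ℝ) / (c₀ * (1 - σ / L) ^ 7) * Real.log T ^ 4 ≤
      2 * L ^ 2 * (d : ℝ) ^ (3 / 2 : ℝ) * Real.log (d * T) ^ 4 / (c₀ * (1 - σ / L) ^ 7) := by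
    rw [div_mul_eq_mul_div]
    gcongr
  have h5 : 0 ≤ 2 * L ^ 2 * (d : ℝ) ^ (3 / 2 : ℝ) / (c₀ * (1 - σ / L) ^ 7) * Real.log T ^ 4 := by
    positivity
  rw [kappa]
  constructor <;> linarith

/-- Here `v` stands for `√(log T)`: the noise level is linear in `v`, the number of epochs
quadratic, so the distance factor is cubic and the regret constant of order `v⁶ = log³ T`. -/
theorem abs_distBound_le {s₀ : ℕ} {p c v : ℝ} (hp : 0 < p) (hL : 0 < L) (hc : 0 ≤ c)
    (hv : 1 ≤ v) :
    |distBound d s₀ p B L (√24 * v) (1 + c * v ^ 2)| ≤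
      (|B * (p ^ s₀)⁻¹| + (1 + c) * (d / L * (√24 + 1 + L) / p)) * v ^ 3 := by
  have hv2 : 1 ≤ v ^ 2 := one_le_pow₀ hv
  have hv3 : 1 ≤ v ^ 3 := one_le_pow₀ hv
  have h1 : 1 + c * v ^ 2 ≤ (1 + c) * v ^ 2 := by linarith
  have h2 : √24 * v + 1 + L ≤ (√24 + 1 + L) * v := by
    have := mul_le_mul_of_nonneg_left hv (show 0 ≤ 1 + L by positivity)
    linarith
  have h3 : 0 ≤ (1 + c * v ^ 2) * (d / L * (√24 * v + 1 + L) / p) := by positivity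
  rw [distBound]
  refine (abs_add_le _ _).trans ?_
  rw [abs_of_nonneg h3, add_mul |B * (p ^ s₀)⁻¹|]
  refine add_le_add (le_mul_of_one_le_right (abs_nonneg _) hv3) ?_
  calc _ ≤ ((1 + c) * v ^ 2) * (d / L * ((√24 + 1 + L) * v) / p) := by gcongr
    _ = _ := by ring

theorem exists_regretBound_le (d s₀ : ℕ) (B : ℝ) {p c : ℝ} (N n₀ : ℝ) (hp : 0 < p) (hL : 0 < L)
    (hc : 0 ≤ c) :
    ∃ M, 0 ≤ M ∧ ∀ v, 1 ≤ v →
      regretBound d s₀ p B L (√24 * v) N n₀ (1 + c * v ^ 2) ≤ M * v ^ 6 := by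
  set M := |B * (p ^ s₀)⁻¹| + (1 + c) * (d / L * (√24 + 1 + L) / p) with hM
  refine ⟨(2 * L * (√(2 * N) * M ^ 2 + 1) + 2 * √n₀) * √(4 * d / (1 - p ^ 4)), by positivity,
    fun v hv => ?_⟩
  have h1 := abs_distBound_le (d := d) (B := B) (s₀ := s₀) hp hL hc hv
  rw [← hM] at h1
  have h2 : distBound d s₀ p B L (√24 * v) (1 + c * v ^ 2) ^ 2 ≤ M ^ 2 * v ^ 6 := by
    rw [← sq_abs, show M ^ 2 * v ^ 6 = (M * v ^ 3) ^ 2 by ring]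
    gcongr
  have hv6 : 1 ≤ v ^ 6 := one_le_pow₀ hv
  rw [regretBound, mul_right_comm _ (√(4 * d / (1 - p ^ 4))) (v ^ 6)]
  gcongr ?_ * _
  calc _ ≤ 2 * L * (√(2 * N) * (M ^ 2 * v ^ 6) + v ^ 6) + 2 * √n₀ * v ^ 6 := by
        refine add_le_add ?_ (le_mul_of_one_le_right (by positivity) hv6)
        gcongr
    _ = _ := by ring

/-- The constant `κ₀`, of order `log T ^ 4`, eventually dominates the regret and the noise. -/
theorem eventually_regretBound_le_kappa (hd : 1 ≤ d) (s₀ : ℕ) (N n₀ : ℝ) (hσ : 0 < σ)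
    (hσL : σ < L) (hc₀ : 0 < c₀) :
    ∀ᶠ T : ℕ in atTop, 3 * (2 * regretBound d s₀ (1 - σ / L) B L √(24 * Real.log T) N n₀
      (1 + Real.log T / (4 * Real.log (1 - σ / L)⁻¹)) + √(24 * Real.log T)) ≤
        2 * kappa d T B L σ c₀ ∧ 1 ≤ kappa d T B L σ c₀ := by
  have hL : 0 < L := hσ.trans hσL
  have hp : 0 < 1 - σ / L := by rwa [sub_pos, div_lt_one hL]
  have hp1 : 1 - σ / L < 1 := by rw [sub_lt_self_iff]; positivity
  have hlog : 0 < Real.log (1 - σ / L)⁻¹ := Real.log_pos ((one_lt_inv₀ hp).mpr hp1)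
  have hd' : (0 : ℝ) < d := by exact_mod_cast hd
  obtain ⟨M, hM0, hM⟩ := exists_regretBound_le d s₀ B N n₀ hp hL
    (show 0 ≤ (4 * Real.log (1 - σ / L)⁻¹)⁻¹ by positivity)
  set c := 2 * L ^ 2 * (d : ℝ) ^ (3 / 2 : ℝ) / (c₀ * (1 - σ / L) ^ 7) with hc
  have hcpos : 0 < c := by positivity
  have hlim : Tendsto (fun T : ℕ => Real.log T) atTop atTop :=
    Real.tendsto_log_atTop.comp tendsto_natCast_atTop_atTop
  filter_upwards [hlim.eventually_ge_atTop 1, hlim.eventually_ge_atTop (1 / c),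
    hlim.eventually_ge_atTop ((6 * M + 3 * √24) / (2 * c)), eventually_ge_atTop 1]
    with T h1 h2 h3 hT
  -- Only the last summand of `κ₀` is used; its extra factor `log T` beats every constant.
  have hκ := (le_kappa (B := B) hd hT hL hσL hc₀).2
  rw [← hc] at hκ
  set l := Real.log T
  set v := √l with hv
  have hv1 : 1 ≤ v := Real.one_le_sqrt.mpr h1
  have hvl : v ^ 2 = l := Real.sq_sqrt (by linarith)
  have hR := hM v hv1
  have hK : √(24 * l) = √24 * v := Real.sqrt_mul (by norm_num) _
  rw [hK, div_eq_mul_inv l, mul_comm l, ← hvl]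
  rw [div_le_iff₀ hcpos] at h2
  rw [div_le_iff₀ (by positivity)] at h3
  have hl3 : 1 ≤ l ^ 3 := one_le_pow₀ h1
  have hv6 : v ^ 6 = l ^ 3 := by rw [← hvl]; ring
  have hvv : v ≤ v ^ 6 := le_self_pow₀ hv1 (by norm_num)
  rw [hv6] at hR hvv
  constructor
  · have e1 : √24 * v ≤ √24 * l ^ 3 := by gcongr
    have e2 : (6 * M + 3 * √24) * l ^ 3 ≤ l * (2 * c) * l ^ 3 := by gcongr
    nlinarith
  · have e1 : 1 * 1 ≤ l * c * l ^ 3 := by gcongr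
    linarith

end Parameters

/-! ### The event of small noise. -/

section Probability

variable {Ω : Type*} {mΩ : MeasurableSpace Ω} {μ : Measure Ω} [IsProbabilityMeasure μ]

/-- Subadditivity on a cover of the whole space, so that no measurability of the good event `G` is
needed. -/
theorem one_sub_le_measureReal {N E G : Set Ω} {p : ℝ} (hN : μ N = 0) (hE : μ.real E ≤ p)
    (h : ∀ ω, ω ∉ N → ω ∉ E → ω ∈ G) : 1 - p ≤ μ.real G := by
  have h1 : (Set.univ : Set Ω) ⊆ N ∪ E ∪ G := by
    intro ω _
    by_cases hωN : ω ∈ N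
    · exact Or.inl (Or.inl hωN)
    · by_cases hωE : ω ∈ E
      · exact Or.inl (Or.inr hωE)
      · exact Or.inr (h ω hωN hωE)
  have h2 := measureReal_mono (μ := μ) h1
  have h3 := measureReal_union_le (μ := μ) (N ∪ E) G
  have h4 := measureReal_union_le (μ := μ) N E
  have h5 : μ.real N = 0 := by rw [measureReal_def, hN, ENNReal.toReal_zero]
  rw [probReal_univ] at h2
  linarith

/-- The constant `24 = 8 * 3` is chosen to give `T⁻³` per event, hence `T⁻²` after a union over at
most `T` prefixes and `d * T` blocks. -/
theorem exp_neg_sq_div_le {T n : ℕ} (hT : 1 ≤ T) (hn : 0 < n) :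
    Real.exp (-((√(24 * Real.log T) * √(n : ℝ)) ^ 2 / (8 * n))) = ((T : ℝ) ^ 3)⁻¹ := by
  have hn' : (n : ℝ) ≠ 0 := by positivity
  have hTpos : (0 : ℝ) < T := by exact_mod_cast hT
  have hl : 0 ≤ Real.log T := Real.log_natCast_nonneg T
  rw [mul_pow, Real.sq_sqrt (by positivity), Real.sq_sqrt (by positivity),
    show 24 * Real.log T * n / (8 * n) = 3 * Real.log T by field_simp; ring,
    Real.exp_neg, show (3 : ℝ) * Real.log T = (3 : ℕ) * Real.log T by norm_num, ← Real.log_pow,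
    Real.exp_log (by positivity)]

variable {d : ℕ} {P : Params} {X : Set (Vec d)} {f : ℕ → Vec d → ℝ} {T t : ℕ} {B L σ : ℝ}
  {ℱ : Filtration ℕ mΩ} {z₀ : Vec d} {y : ℕ → Ω → ℝ}

/-- With high probability the noise is small along all prefixes and all completed blocks. -/
theorem measureReal_noise_le {x : ℕ → Ω → Vec d} (hT : 1 ≤ T) (htT : t ≤ T) (hd : 1 ≤ d)
    (h0 : 0 < 1 - P.γ) (h1 : 1 - P.γ < 1) (hN : 1 ≤ P.N₀) (hF : Feedback μ ℱ X f T x y) :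
    μ.real ((⋃ r ∈ Finset.Icc 1 t, {ω | √(24 * Real.log T) * √(r : ℝ) ≤
        |∑ k ∈ Finset.Icc 1 r, (y k ω - (μ[y k | ℱ (k - 1)]) ω)|}) ∪
      ⋃ i ∈ Finset.range T ×ˢ (Finset.univ : Finset (Fin d)),
        {ω | P.epochStart d (i.1 + 1) ≤ t ∧
          √(24 * Real.log T) * √(2 * P.batch i.1 : ℕ) ≤
          |∑ k ∈ Finset.range (2 * P.batch i.1), (-1) ^ k * (y (P.blockStart d i.1 i.2 + k) ω -
            (μ[y (P.blockStart d i.1 i.2 + k) | ℱ (P.blockStart d i.1 i.2 + k - 1)]) ω)|}) ≤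
      (2 + 2 * d) * ((T : ℝ) ^ 2)⁻¹ := by
  have hTpos : (0 : ℝ) < T := by exact_mod_cast hT
  have hone : ∀ r ∈ Finset.Icc 1 t, μ.real {ω | √(24 * Real.log T) * √(r : ℝ) ≤
      |∑ k ∈ Finset.Icc 1 r, (y k ω - (μ[y k | ℱ (k - 1)]) ω)|} ≤ 2 * ((T : ℝ) ^ 3)⁻¹ := by
    intro r hr
    obtain ⟨hr1, hrt⟩ := Finset.mem_Icc.mp hr
    have := measureReal_le_abs_sum_sub_condExp hF.adapted hF.bounded
      (Finset.Icc_subset_Icc le_rfl (hrt.trans htT)) (w := fun _ => 1) (by simp) hr1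
      (show (Finset.Icc 1 r).card ≤ r by simp)
      (show 0 ≤ √(24 * Real.log T) * √(r : ℝ) by positivity)
    rw [exp_neg_sq_div_le hT hr1] at this
    simpa only [one_mul] using this
  have htwo : ∀ i ∈ Finset.range T ×ˢ (Finset.univ : Finset (Fin d)),
      μ.real {ω | P.epochStart d (i.1 + 1) ≤ t ∧
          √(24 * Real.log T) * √(2 * P.batch i.1 : ℕ) ≤
          |∑ k ∈ Finset.range (2 * P.batch i.1), (-1) ^ k * (y (P.blockStart d i.1 i.2 + k) ω -
            (μ[y (P.blockStart d i.1 i.2 + k) | ℱ (P.blockStart d i.1 i.2 + k - 1)]) ω)|} ≤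
        2 * ((T : ℝ) ^ 3)⁻¹ := by
    rintro ⟨s, j⟩ _
    simp only
    by_cases hs : P.epochStart d (s + 1) ≤ t
    · have hn : 0 < 2 * P.batch s := by have := P.batch_pos h0 h1 hN s; omega
      set b := P.blockStart d s j with hb
      have hsub : Finset.Ico b (b + 2 * P.batch s) ⊆ Finset.Icc 1 T := by
        intro k hk
        obtain ⟨hk1, hk2⟩ := Finset.mem_Ico.mp hk
        have e1 := Run.blockStart_add_mem (k := k - b) hs j (by omega)
        rw [← hb, Nat.add_sub_of_le hk1] at e1
        exact Finset.Icc_subset_Icc le_rfl htT e1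
      -- The schedule is deterministic, so the signs are fixed weights, and centring at conditional
      -- means takes care of the dependence of the queries on the past.
      have := measureReal_le_abs_sum_sub_condExp hF.adapted hF.bounded hsub
        (w := fun k => (-1) ^ (k - b)) (by simp) hn (by simp)
        (show 0 ≤ √(24 * Real.log T) * √(2 * P.batch s : ℕ) by positivity)
      rw [exp_neg_sq_div_le hT hn] at this
      simp only [Finset.sum_Ico_eq_sum_range, Nat.add_sub_cancel_left] at this
      simpa only [hs, true_and] using this
    · simp only [hs, false_and, Set.ofPred_false, measureReal_empty]
      positivity
  refine (measureReal_union_le _ _).trans ((add_le_add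
    ((measureReal_biUnion_finset_le _ _).trans (Finset.sum_le_sum hone))
    ((measureReal_biUnion_finset_le _ _).trans (Finset.sum_le_sum htwo))).trans ?_)
  simp only [Finset.sum_const, Nat.card_Icc, Nat.add_sub_cancel, Finset.card_product,
    Finset.card_range, Finset.card_univ, Fintype.card_fin, nsmul_eq_mul, Nat.cast_mul]
  have ht' : (t : ℝ) ≤ T := by exact_mod_cast htT
  calc _ ≤ (T : ℝ) * (2 * ((T : ℝ) ^ 3)⁻¹) + T * d * (2 * ((T : ℝ) ^ 3)⁻¹) := by gcongr
    _ = _ := by field_simp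

end Probability

/-! ### Assembly of the theorem. -/

theorem strictAntiOn_div_sqrt {c : ℝ} (hc : 0 < c) :
    StrictAntiOn (fun t : ℝ => c / √t) (Set.Ioi 0) := fun _ hs _ _ hst =>
  div_lt_div_of_pos_left hc (Real.sqrt_pos.mpr hs) (Real.sqrt_lt_sqrt (le_of_lt hs) hst)

theorem strictMonoOn_mul_div_sqrt {c : ℝ} (hc : 0 < c) :
    StrictMonoOn (fun t : ℝ => t * (c / √t)) (Set.Ioi 0) := by
  intro s hs t _ hst
  have h : ∀ t : ℝ, t * (c / √t) = c * √t := fun t => by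
    rw [mul_div_left_comm, Real.div_sqrt]
  simp only [h]
  exact mul_lt_mul_of_pos_left (Real.sqrt_lt_sqrt (le_of_lt hs) hst) hc

theorem isSoftO_ite (T₀ : ℕ) (C : ℝ) :
    IsSoftO (fun T => if T < T₀ then 1 else C * ((T : ℝ) ^ 2)⁻¹) fun T => ((T : ℝ) ^ 2)⁻¹ := by
  refine ⟨1, one_pos, IsBigO.of_bound |C| ?_⟩
  have hlim : Tendsto (fun T : ℕ => Real.log T) atTop atTop :=
    Real.tendsto_log_atTop.comp tendsto_natCast_atTop_atTop
  filter_upwards [eventually_ge_atTop T₀, hlim.eventually_ge_atTop 1] with T h1 h2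
  rw [if_neg (by omega), Real.rpow_one, norm_mul, norm_mul, Real.norm_eq_abs C]
  gcongr
  refine le_mul_of_one_le_right (norm_nonneg _) ?_
  rw [Real.norm_eq_abs]
  exact h2.trans (le_abs_self _)

/-- The two bounds hold with high probability once `κ₀` dominates the regret and the noise. -/
theorem one_sub_le_measureReal_rbar {Ω : Type*} {mΩ : MeasurableSpace Ω} {μ : Measure Ω}
    [IsProbabilityMeasure μ] {d : ℕ} {P : Params} {X : Set (Vec d)} {f : ℕ → Vec d → ℝ}
    {T t s₀ : ℕ} {B L σ : ℝ} {ℱ : Filtration ℕ mΩ} {z₀ : Vec d} {y : ℕ → Ω → ℝ}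
    (hd : 1 ≤ d) (hσ : 0 < σ) (hσL : σ < L) (hc₀ : 0 < P.c₀) (hγ : P.γ = σ / L)
    (hη : P.η₀ = 1 / L) (hN : 1 ≤ P.N₀) (hA : Assumptions X f T B L σ P.c₀)
    (hz₀ : z₀ ∈ innerPart X P.c₀)
    (hF : Feedback μ ℱ X f T (fun t ω => P.query X z₀ (fun τ => y τ ω) t) y)
    (hs₀ : (1 - P.γ) ^ s₀ ≤ P.c₀)
    (hκ : 3 * (2 * regretBound d s₀ (1 - P.γ) B L √(24 * Real.log T) P.N₀ (P.batch s₀)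
      (1 + Real.log T / (4 * Real.log (1 - P.γ)⁻¹)) + √(24 * Real.log T)) ≤ 2 * P.κ₀)
    (hκ1 : 1 ≤ P.κ₀) (ht : t ∈ Finset.Icc 1 T) (hvar : variation X f 1 t ≤ 1 / √t) :
    1 - (2 + 2 * d) * ((T : ℝ) ^ 2)⁻¹ ≤ μ.real {ω |
      (⨅ τ : Set.Icc 1 t, maxValue X (f τ)) - 6 * P.κ₀ * variation X f 1 t ≤
        P.rbar (fun τ => y τ ω) t ∧
      (1 / (t : ℝ)) * ∑ τ ∈ Finset.Icc 1 t, (P.rbar (fun τ => y τ ω) τ - y τ ω) ≤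
        6 * P.κ₀ / √t + 6 * P.κ₀ * variation X f 1 t} := by
  obtain ⟨ht1, htT⟩ := Finset.mem_Icc.mp ht
  have hL : 0 < L := hσ.trans hσL
  have h0 : 0 < 1 - P.γ := by rwa [hγ, sub_pos, div_lt_one hL]
  have h1 : 1 - P.γ < 1 := by rw [hγ, sub_lt_self_iff]; positivity
  have hT : 1 ≤ T := ht1.trans htT
  obtain ⟨x, hx, hx0, hxmax⟩ := hA.exists_maximizer hc₀ (Finset.mem_Icc.mpr ⟨le_rfl, hT⟩)
  have hae : ∀ᵐ ω ∂μ, ∀ r ∈ Finset.Icc 1 T, |(μ[y r | ℱ (r - 1)]) ω| ≤ 1 ∧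
      (P.query X z₀ (fun τ => y τ ω) r ∈ X →
        (μ[y r | ℱ (r - 1)]) ω = f r (P.query X z₀ (fun τ => y τ ω) r)) := by
    rw [Finset.eventually_all]
    intro r hr
    exact (ae_bdd_abs_condExp_of_ae_bdd_abs (hF.bounded r hr)).and (hF.unbiased r hr)
  refine one_sub_le_measureReal (ae_iff.mp hae)
    (measureReal_noise_le hT htT hd h0 h1 hN hF) fun ω hω hE => ?_
  have hω := not_not.mp hω
  simp only [Set.mem_union, Set.mem_iUnion, not_or, not_exists, Set.mem_ofPred_eq, not_and,
    not_le] at hE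
  have hrun : Run P X f T t B L σ √(24 * Real.log T) z₀ (fun τ => y τ ω)
      fun τ => (μ[y τ | ℱ (τ - 1)]) ω :=
    { dim_pos := hd
      sigma_pos := hσ
      sigma_lt := hσL
      c₀_pos := hc₀
      gamma_eq := hγ
      eta_eq := hη
      one_le_N₀ := hN
      assumptions := hA
      start_mem := hz₀
      one_le := ht1
      le_horizon := htT
      K_nonneg := Real.sqrt_nonneg _
      variation_le := hvar
      mean_le := fun r hr => (hω r (Finset.Icc_subset_Icc le_rfl htT hr)).1
      mean_eq := fun r hr => (hω r (Finset.Icc_subset_Icc le_rfl htT hr)).2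
      prefix_le := fun r hr => (hE.1 r hr).le
      block_le := fun s hs j => by
        -- A completed epoch has index below `T`, so its blocks belong to the union that was
        -- bounded.
        have := Params.lt_epochStart h0 h1 hN hd (s + 1)
        exact (hE.2 (s, j) (by simp only [Finset.mem_product, Finset.mem_range,
          Finset.mem_univ, and_true]; omega) hs).le }
  have hR : 0 ≤ regretBound d s₀ (1 - P.γ) B L √(24 * Real.log T) P.N₀ (P.batch s₀)
      (1 + Real.log T / (4 * Real.log (1 - P.γ)⁻¹)) := by
    rw [regretBound]
    positivity
  have hb := hrun.rbar_bounds hR (fun r hr => hrun.abs_sub_mean_le hs₀ hx hx0 hr) hκ hκ1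
  refine ⟨le_trans (sub_le_sub_right ?_ _) hb.1, hb.2⟩
  -- The minimum of the maxima is at most its term at time `1`.
  rw [← hxmax]
  exact ciInf_le (f := fun τ : Set.Icc 1 t => maxValue X (f τ)) (Set.finite_range _).bddBelow
    ⟨1, le_rfl, ht1⟩

end Bandit

theorem lemma2 (d : ℕ) (hd : 1 ≤ d) (B L σ c₀ : ℝ) (hσ : 0 < σ) (hσL : σ < L)
    (hc₀ : 0 < c₀) (hc₁ : c₀ < 1) :
    ∃ a : ℕ → ℝ, Bandit.IsSoftO a (fun T => ((T : ℝ) ^ 2)⁻¹) ∧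
      ∀ T : ℕ, 1 ≤ T →
      ∀ (X : Set (Bandit.Vec d)) (f : ℕ → Bandit.Vec d → ℝ),
        Bandit.Assumptions X f T B L σ c₀ →
      ∀ z₀ ∈ Bandit.innerPart X c₀,
      ∀ {Ω : Type*} {mΩ : MeasurableSpace Ω} (μ : Measure Ω) [IsProbabilityMeasure μ]
        (ℱ : Filtration ℕ mΩ) (y : ℕ → Ω → ℝ),
        Bandit.Feedback μ ℱ X f T
          (fun t ω => (Bandit.theParams d T B L σ c₀).query X z₀ (fun τ => y τ ω) t) y →
        Bandit.WeaklyNonstationary μ X f T y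
          (fun t ω => (Bandit.theParams d T B L σ c₀).rbar (fun τ => y τ ω) t)
          (fun t => 6 * Bandit.kappa d T B L σ c₀ / √t)
          (6 * Bandit.kappa d T B L σ c₀) (a T) := by
  have hL : 0 < L := hσ.trans hσL
  obtain ⟨s₀, hs₀⟩ := exists_pow_lt_of_lt_one hc₀
    (show 1 - σ / L < 1 by rw [sub_lt_self_iff]; positivity)
  obtain ⟨T₀, hT₀⟩ := eventually_atTop.mp (Bandit.eventually_regretBound_le_kappa (B := B) hd s₀
    (Bandit.theParams d 1 B L σ c₀).N₀ ((Bandit.theParams d 1 B L σ c₀).batch s₀) hσ hσL hc₀)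
  refine ⟨_, Bandit.isSoftO_ite T₀ (2 + 2 * d), ?_⟩
  intro T hT X f hA z₀ hz₀ Ω mΩ μ _ ℱ y hF
  have hκ : 0 < 6 * Bandit.kappa d T B L σ c₀ := by
    have := (Bandit.le_kappa (B := B) hd hT hL hσL hc₀).1
    linarith
  refine ⟨Bandit.strictAntiOn_div_sqrt hκ, Bandit.strictMonoOn_mul_div_sqrt hκ, hκ,
    fun t ht hvar => ?_⟩
  split_ifs with hlt
  · rw [sub_self]
    exact measureReal_nonneg
  · have hvar' : Bandit.variation X f 1 t ≤ 1 / √t := by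
      rwa [div_div_cancel_left' hκ.ne', ← one_div] at hvar
    obtain ⟨hκ', hκ1⟩ := hT₀ T (not_lt.mp hlt)
    exact Bandit.one_sub_le_measureReal_rbar (P := Bandit.theParams d T B L σ c₀) hd hσ hσL hc₀
      rfl rfl (Nat.le_add_left _ _) hA hz₀ hF hs₀.le hκ' hκ1 ht hvar'
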